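/- Conventions. All Banach and Hilbert spaces are separable. A (real) Banach--Lie superalgebra is a Lie superalgebra $\mathfrak g=\mathfrak g_{\bar 0}\oplus\mathfrak g_{\bar 1}$ over $\mathbb R$ that is a Banach space with closed $\mathfrak g_{\bar 0},\mathfrak g_{\bar 1}$ and $\|[x,y]\|\le\|x\|\,\|y\|$. A Banach--Lie supergroup $(G,\mathfrak g)$ consists of a (real analytic) Banach--Lie group $G$ and a real Banach--Lie superalgebra $\mathfrak g$ with $\mathfrak g_{\bar 0}=\mathrm{Lie}(G)$, together with an analytic homomorphism $\mathrm{Ad}$ from $G$ to the group of continuous even automorphisms of $\mathfrak g$ with $\mathsf d_e\mathrm{Ad}(x)=\mathrm{ad}_x$ for $x\in\mathfrak g_{\bar 0}$; $\mathrm{Ad}(g)$ is extended $\mathbb C$-linearly to $\mathfrak g^{\mathbb C}=\mathfrak g\otimes_{\mathbb R}\mathbb C$. For a strongly continuous unitary representation $(\pi,\mathscr H)$ of $G$, $\mathsf d\pi(x)$ denotes the skew-adjoint infinitesimal generator of $t\mapsto\pi(\exp(tx))$, for $x\in\mathfrak g_{\bar 0}$, and $\mathscr H^\infty$ is the space of all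 $v\in\mathscr H$ such that $g\mapsto\pi(g)v$ is smooth. A pre-representation $(\pi,\mathscr H,\mathscr B,\rho^{\mathscr B})$ of $(G,\mathfrak g)$ consists of the following data. (i) $(\pi,\mathscr H)$ is a strongly continuous unitary representation of $G$ by even operators on a complex $\mathbb Z_2$-graded Hilbert space $\mathscr H=\mathscr H_{\bar 0}\oplus\mathscr H_{\bar 1}$ (orthogonal direct sum). (ii) $\mathscr B\subseteq\bigcap_{x\in\mathfrak g_{\bar 0}}\mathcal D(\mathsf d\pi(x))$ is a dense $\mathbb Z_2$-graded subspace of $\mathscr H$. (iii) $\rho^{\mathscr B}:\mathfrak g\to\mathrm{End}_{\mathbb C}(\mathscr B)$ is a representation of the Lie superalgebra $\mathfrak g$ (no continuity required). (iv) For $x\in\mathfrak g_{\bar 0}$, $\rho^{\mathscr B}(x)=\mathsf d\pi(x)|_{\mathscr B}$, and this operator is essentially skew-adjoint. (v) For $x\in\mathfrak g_{\bar 1}$, $e^{-\pi i/4}\rho^{\mathscr B}(x)$ is symmetric. (vi) Every coset of the identity component $G^\circ$ in $G$ has a representative $g$ with $\pi(g)^{-1}\mathscr B\subseteq\mathscr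 B$ and $\pi(g)\rho^{\mathscr B}(x)\pi(g)^{-1}=\rho^{\mathscr B}(\mathrm{Ad}(g)x)$ on $\mathscr B$ for all $x\in\mathfrak g_{\bar 1}$ (this is automatic if $G$ is connected). For $x=(a_0+ib_0)+(a_1+ib_1)\in\mathfrak g^{\mathbb C}$ with $a_0,b_0\in\mathfrak g_{\bar 0}$ and $a_1,b_1\in\mathfrak g_{\bar 1}$, let $\tilde\rho^{\mathscr B}(x)$ be the restriction to $\mathscr H^\infty$ of the sum of operator closures $\overline{\rho^{\mathscr B}(a_0)}+i\,\overline{\rho^{\mathscr B}(b_0)}+\overline{\rho^{\mathscr B}(a_1)}+i\,\overline{\rho^{\mathscr B}(b_1)}$. Proposition. Let $(G,\mathfrak g)$ be a Banach--Lie supergroup with $G$ connected, and let $(\pi,\mathscr H,\mathscr B,\rho^{\mathscr B})$ be a pre-representation of $(G,\mathfrak g)$. Then for every $g\in G$, every $x\in\mathfrak g_{\bar 1}^{\mathbb C}$ and every $v\in\mathscr H^\infty$, the vector $\pi(g)^{-1}v$ lies in $\mathscr H^\infty$ and in the domain of $\tilde\rho^{\mathscr B}(x)$, the vector $v$ lies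 in the domain of $\tilde\rho^{\mathscr B}(\mathrm{Ad}(g)x)$, and $$\pi(g)\,\tilde\rho^{\mathscr B}(x)\,\pi(g)^{-1}v=\tilde\rho^{\mathscr B}(\mathrm{Ad}(g)x)\,v .$$ -/

import Mathlib

open scoped Manifold ContDiff TensorProduct InnerProductSpace

noncomputable section

/-! ### Banach-Lie superalgebras -/

/-- The sign `(-1)^{ij}` of the super sign rule, for parities `i` and `j`. -/
def superSign (i j : ZMod 2) : ℝ := (-1) ^ (i.val * j.val)

/-- A real Banach-Lie superalgebra structure on the real Banach space `𝔤`; `part 0` and `part 1`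
are the even and the odd part. -/
structure BanachLieSuperalgebra (𝔤 : Type*) [NormedAddCommGroup 𝔤] [NormedSpace ℝ 𝔤]
    [CompleteSpace 𝔤] where
  part : ZMod 2 → Submodule ℝ 𝔤
  isCompl_part : IsCompl (part 0) (part 1)
  isClosed_part : ∀ i, IsClosed (part i : Set 𝔤)
  bracket : 𝔤 →ₗ[ℝ] 𝔤 →ₗ[ℝ] 𝔤
  bracket_mem : ∀ (i j : ZMod 2) (x y : 𝔤), x ∈ part i → y ∈ part j → bracket x y ∈ part (i + j)
  bracket_skew : ∀ (i j : ZMod 2) (x y : 𝔤), x ∈ part i → y ∈ part j →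
    bracket x y = -(superSign i j • bracket y x)
  bracket_jacobi : ∀ (i j : ZMod 2) (x y z : 𝔤), x ∈ part i → y ∈ part j →
    bracket x (bracket y z) = bracket (bracket x y) z + superSign i j • bracket y (bracket x z)
  norm_bracket_le : ∀ x y : 𝔤, ‖bracket x y‖ ≤ ‖x‖ * ‖y‖

namespace BanachLieSuperalgebra

variable {𝔤 : Type*} [NormedAddCommGroup 𝔤] [NormedSpace ℝ 𝔤] [CompleteSpace 𝔤]

/-- The even component `x₀` of `x = x₀ + x₁`. -/
def evenComponent (A : BanachLieSuperalgebra 𝔤) : 𝔤 →ₗ[ℝ] 𝔤 := Submodule.projection (A.part 0) (A.part 1) A.isCompl_part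

/-- The odd component `x₁` of `x = x₀ + x₁`. -/
def oddComponent (A : BanachLieSuperalgebra 𝔤) : 𝔤 →ₗ[ℝ] 𝔤 := Submodule.projection (A.part 1) (A.part 0) A.isCompl_part.symm

/-- The odd part of the complexification `ℂ ⊗ 𝔤`. -/
def oddPartC (A : BanachLieSuperalgebra 𝔤) : Submodule ℂ (ℂ ⊗[ℝ] 𝔤) := (A.part 1).baseChange ℂ

end BanachLieSuperalgebra

/-! ### Real and imaginary parts in a complexification -/

section Complexification

variable {V : Type*} [AddCommGroup V] [Module ℝ V]

/-- The component `a` of `a + i b = 1 ⊗ a + i ⊗ b` in `ℂ ⊗ V`. -/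
def reC : ℂ ⊗[ℝ] V →ₗ[ℝ] V := (TensorProduct.lid ℝ V).toLinearMap ∘ₗ Complex.reLm.rTensor V

/-- The component `b` of `a + i b = 1 ⊗ a + i ⊗ b` in `ℂ ⊗ V`. -/
def imC : ℂ ⊗[ℝ] V →ₗ[ℝ] V := (TensorProduct.lid ℝ V).toLinearMap ∘ₗ Complex.imLm.rTensor V

end Complexification

/-! ### The exponential map of a Banach-Lie group -/

section Exponential

variable {E : Type*} [NormedAddCommGroup E] [NormedSpace ℝ E]
  {G : Type*} [TopologicalSpace G] [ChartedSpace E G] [Group G] [LieGroup 𝓘(ℝ, E) ω G]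

lemma isMIntegralCurveOn_const_mul {x : GroupLieAlgebra 𝓘(ℝ, E) G} {γ : ℝ → G} {s : Set ℝ}
    (hγ : IsMIntegralCurveOn (I := 𝓘(ℝ, E)) γ (mulInvariantVectorField x) s) (g : G) :
    IsMIntegralCurveOn (I := 𝓘(ℝ, E)) (fun t => g * γ t) (mulInvariantVectorField x) s := by
  intro t ht
  have hd : ∀ a b : G, MDifferentiableAt 𝓘(ℝ, E) 𝓘(ℝ, E) (fun y : G => a * y) b := fun a b =>
    (contMDiff_mul_left (I := 𝓘(ℝ, E)) (n := ω)).mdifferentiableAt (by simp)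
  have h := (hd g (γ t)).hasMFDerivAt.comp_hasMFDerivWithinAt t (hγ t ht)
  have e : mulInvariantVectorField (I := 𝓘(ℝ, E)) x (g * γ t)
      = mfderiv 𝓘(ℝ, E) 𝓘(ℝ, E) (fun y : G => g * y) (γ t)
        (mulInvariantVectorField (I := 𝓘(ℝ, E)) x (γ t)) := by
    have hc := (hd g (γ t * 1)).hasMFDerivAt.comp (1 : G) (hd (γ t) 1).hasMFDerivAt
    have c' : (fun y : G => g * y) ∘ (fun y : G => γ t * y) = fun y => g * γ t * y := by
      ext y; simp [mul_assoc]
    rw [c'] at hc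
    have key : ∀ b : G, γ t * 1 = b → mulInvariantVectorField (I := 𝓘(ℝ, E)) x (g * γ t)
        = mfderiv 𝓘(ℝ, E) 𝓘(ℝ, E) (fun y : G => g * y) b
          (mulInvariantVectorField (I := 𝓘(ℝ, E)) x (γ t)) := by
      rintro b rfl
      exact DFunLike.congr_fun hc.mfderiv x
    exact key _ (mul_one _)
  have e' : (1 : ℝ →L[ℝ] ℝ).smulRight (mulInvariantVectorField (I := 𝓘(ℝ, E)) x (g * γ t))
      = (mfderiv 𝓘(ℝ, E) 𝓘(ℝ, E) (fun y : G => g * y) (γ t)).comp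
        ((1 : ℝ →L[ℝ] ℝ).smulRight (mulInvariantVectorField (I := 𝓘(ℝ, E)) x (γ t))) := by
    rw [e]
    exact ContinuousLinearMap.ext fun r => (ContinuousLinearMap.map_smul _ _ _).symm
  exact e' ▸ h

/-- Every tangent vector at the identity generates a left-invariant flow line through the identity
defined for all times. -/
theorem exists_leftInvariant_curve [CompleteSpace E] [T2Space G]
    (x : GroupLieAlgebra 𝓘(ℝ, E) G) :
    ∃ γ : ℝ → G, γ 0 = 1 ∧ IsMIntegralCurve (I := 𝓘(ℝ, E)) γ (mulInvariantVectorField x) := by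
  have : IsManifold 𝓘(ℝ, E) 1 G := IsManifold.of_le (n := ω) le_top
  have hv : ContMDiff 𝓘(ℝ, E) 𝓘(ℝ, E).tangent 1
      (fun g : G => (mulInvariantVectorField x g : TangentBundle 𝓘(ℝ, E) G)) :=
    (contMDiff_mulInvariantVectorField x).of_le (le_trans (by norm_num) le_minSmoothness)
  obtain ⟨γ, h0, hγ⟩ := exists_isMIntegralCurveAt_of_contMDiffAt_boundaryless (t₀ := 0)
    (hv.contMDiffAt (x := (1 : G)))
  rw [isMIntegralCurveAt_iff'] at hγ
  obtain ⟨ε, hε, hγ⟩ := hγ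
  refine exists_isMIntegralCurve_of_isMIntegralCurveOn hv hε (fun g => ⟨fun t => g * γ t, ?_, ?_⟩) 1
  · simp [h0]
  · rw [Real.ball_eq_Ioo] at hγ
    simpa using isMIntegralCurveOn_const_mul hγ g

/-- The exponential map `exp : Lie(G) → G`: the value at time `1` of the integral curve through the
identity of the left-invariant vector field generated by `x`. -/
def lieExp [CompleteSpace E] [T2Space G] (x : GroupLieAlgebra 𝓘(ℝ, E) G) : G :=
  (exists_leftInvariant_curve x).choose 1

end Exponential

/-! ### Banach-Lie supergroups -/

/-- A Banach-Lie supergroup `(G, 𝔤)`: the even part of `𝔤` is identified, as a topological Lie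
algebra, with the Lie algebra of the Banach-Lie group `G` (modelled on `E`), and `Ad` is an analytic
homomorphism from `G` to the group of continuous even automorphisms of `𝔤` whose differential at
the identity is the adjoint representation. -/
structure BanachLieSupergroup (E G 𝔤 : Type*)
    [NormedAddCommGroup E] [NormedSpace ℝ E] [CompleteSpace E]
    [TopologicalSpace G] [ChartedSpace E G] [Group G] [LieGroup 𝓘(ℝ, E) ω G]
    [NormedAddCommGroup 𝔤] [NormedSpace ℝ 𝔤] [CompleteSpace 𝔤] where
  alg : BanachLieSuperalgebra 𝔤
  lieEquiv : GroupLieAlgebra 𝓘(ℝ, E) G ≃L[ℝ] alg.part 0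
  lieEquiv_bracket : ∀ x y : GroupLieAlgebra 𝓘(ℝ, E) G,
    (lieEquiv ⁅x, y⁆ : 𝔤) = alg.bracket (lieEquiv x) (lieEquiv y)
  Ad : G →* (𝔤 ≃L[ℝ] 𝔤)
  Ad_mem : ∀ (g : G) (i : ZMod 2) (x : 𝔤), x ∈ alg.part i → Ad g x ∈ alg.part i
  Ad_bracket : ∀ (g : G) (x y : 𝔤), Ad g (alg.bracket x y) = alg.bracket (Ad g x) (Ad g y)
  Ad_analytic : ContMDiff 𝓘(ℝ, E) 𝓘(ℝ, 𝔤 →L[ℝ] 𝔤) ω (fun g : G => (Ad g : 𝔤 →L[ℝ] 𝔤))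
  mfderiv_Ad : ∀ (x : GroupLieAlgebra 𝓘(ℝ, E) G) (y : 𝔤),
    (show 𝔤 →L[ℝ] 𝔤 from
      mfderiv 𝓘(ℝ, E) 𝓘(ℝ, 𝔤 →L[ℝ] 𝔤) (fun g : G => (Ad g : 𝔤 →L[ℝ] 𝔤)) 1 x) y
      = alg.bracket (lieEquiv x) y

namespace BanachLieSupergroup

variable {E G 𝔤 : Type*} [NormedAddCommGroup E] [NormedSpace ℝ E] [CompleteSpace E]
  [TopologicalSpace G] [ChartedSpace E G] [Group G] [LieGroup 𝓘(ℝ, E) ω G]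
  [NormedAddCommGroup 𝔤] [NormedSpace ℝ 𝔤] [CompleteSpace 𝔤]

/-- The complex-linear extension of `Ad g` to the complexification of `𝔤`. -/
def AdC (S : BanachLieSupergroup E G 𝔤) (g : G) : ℂ ⊗[ℝ] 𝔤 →ₗ[ℂ] ℂ ⊗[ℝ] 𝔤 :=
  ((S.Ad g : 𝔤 →L[ℝ] 𝔤) : 𝔤 →ₗ[ℝ] 𝔤).baseChange ℂ

end BanachLieSupergroup

/-! ### Unitary representations of Banach-Lie groups -/

/-- A (strongly continuous) unitary representation of a topological group. -/
structure UnitaryRepresentation (G H : Type*) [Group G] [TopologicalSpace G]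
    [NormedAddCommGroup H] [InnerProductSpace ℂ H] where
  toHom : G →* (H ≃ₗᵢ[ℂ] H)
  continuous_orbit : ∀ v : H, Continuous fun g : G => toHom g v

namespace UnitaryRepresentation

variable {E G H : Type*} [NormedAddCommGroup E] [NormedSpace ℝ E]
  [TopologicalSpace G] [ChartedSpace E G] [Group G]
  [NormedAddCommGroup H] [InnerProductSpace ℂ H]

variable (E) in
/-- The space of smooth vectors: those whose orbit map is smooth. -/
def smoothVectors (π : UnitaryRepresentation G H) : Submodule ℂ H where
  carrier := {v | ContMDiff 𝓘(ℝ, E) 𝓘(ℝ, H) ∞ fun g : G => π.toHom g v}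
  zero_mem' := by simpa using contMDiff_const
  add_mem' {v w} hv hw := by
    have h : (fun g : G => π.toHom g (v + w)) = fun g => π.toHom g v + π.toHom g w := by
      ext g; simp
    simp only [Set.mem_ofPred_eq, h] at hv hw ⊢
    exact hv.add hw
  smul_mem' c v hv := by
    have h : (fun g : G => π.toHom g (c • v))
        = (((c • ContinuousLinearMap.id ℂ H : H →L[ℂ] H).restrictScalars ℝ) : H → H)
          ∘ fun g => π.toHom g v := by
      ext g; simp
    simp only [Set.mem_ofPred_eq, h] at hv ⊢
    exact (ContinuousLinearMap.contMDiff _).comp hv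

/-- `dπ(x)`: the infinitesimal generator of the one-parameter unitary group `t ↦ π(exp(tx))`. Its
domain consists of the vectors `v` such that `t ↦ π(exp(tx))v` is differentiable at `0`. -/
def generator [CompleteSpace E] [LieGroup 𝓘(ℝ, E) ω G] [T2Space G]
    (π : UnitaryRepresentation G H) (x : GroupLieAlgebra 𝓘(ℝ, E) G) : H →ₗ.[ℂ] H where
  domain :=
    { carrier := {v | DifferentiableAt ℝ (fun t : ℝ => π.toHom (lieExp (t • x)) v) 0}
      zero_mem' := by simp
      add_mem' := fun {v w} hv hw => by
        simp only [Set.mem_ofPred_eq, map_add] at hv hw ⊢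
        exact hv.add hw
      smul_mem' := fun c v hv => by
        simp only [Set.mem_ofPred_eq, map_smul] at hv ⊢
        exact hv.const_smul c }
  toFun :=
    { toFun := fun v => deriv (fun t : ℝ => π.toHom (lieExp (t • x)) (v : H)) 0
      map_add' := fun v w => by
        simp only [Submodule.coe_add, map_add]
        exact deriv_add v.2 w.2
      map_smul' := fun c v => by
        simp only [Submodule.coe_smul, map_smul, RingHom.id_apply]
        exact deriv_const_smul c v.2 }

end UnitaryRepresentation

/-! ### Pre-representations -/

/-- A densely defined operator is essentially skew-adjoint if it is closable and its closure `T`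
satisfies `T† = -T`. -/
def IsEssentiallySkewAdjoint {H : Type*} [NormedAddCommGroup H] [InnerProductSpace ℂ H]
    [CompleteSpace H] (T : H →ₗ.[ℂ] H) : Prop :=
  Dense (T.domain : Set H) ∧ T.IsClosable ∧ T.closure.adjoint = -T.closure

/-- A pre-representation `(π, H, B, ρ)` of the Banach-Lie supergroup `(G, 𝔤)` on the `ℤ₂`-graded
Hilbert space `H = grading 0 ⊕ grading 1`. -/
structure PreRepresentation {E G 𝔤 : Type*}
    [NormedAddCommGroup E] [NormedSpace ℝ E] [CompleteSpace E]
    [TopologicalSpace G] [T2Space G] [ChartedSpace E G] [Group G] [LieGroup 𝓘(ℝ, E) ω G]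
    [NormedAddCommGroup 𝔤] [NormedSpace ℝ 𝔤] [CompleteSpace 𝔤]
    (S : BanachLieSupergroup E G 𝔤)
    (H : Type*) [NormedAddCommGroup H] [InnerProductSpace ℂ H] [CompleteSpace H] where
  π : UnitaryRepresentation G H
  /-- The even and the odd part of `H`. -/
  grading : ZMod 2 → Submodule ℂ H
  isCompl_grading : IsCompl (grading 0) (grading 1)
  orthogonal_grading : grading 0 ⟂ grading 1
  π_mem : ∀ (g : G) (i : ZMod 2) (v : H), v ∈ grading i → π.toHom g v ∈ grading i
  /-- The common domain of the infinitesimal action. -/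
  B : Submodule ℂ H
  dense_B : Dense (B : Set H)
  graded_B : (B ⊓ grading 0) ⊔ (B ⊓ grading 1) = B
  B_le_domain : ∀ x : GroupLieAlgebra 𝓘(ℝ, E) G, B ≤ (π.generator x).domain
  /-- The action of `𝔤` on `B`; no continuity is required. -/
  ρ : 𝔤 →ₗ[ℝ] Module.End ℂ B
  ρ_mem : ∀ (i j : ZMod 2) (x : 𝔤) (v : B), x ∈ S.alg.part i → (v : H) ∈ grading j →
    (ρ x v : H) ∈ grading (i + j)
  ρ_bracket : ∀ (i j : ZMod 2) (x y : 𝔤), x ∈ S.alg.part i → y ∈ S.alg.part j →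
    ρ (S.alg.bracket x y) = ρ x * ρ y - superSign i j • (ρ y * ρ x)
  ρ_even : ∀ (x : GroupLieAlgebra 𝓘(ℝ, E) G) (v : B),
    (ρ (S.lieEquiv x) v : H) = π.generator x ⟨v, B_le_domain x v.2⟩
  ρ_even_essentiallySkewAdjoint : ∀ x ∈ S.alg.part 0,
    IsEssentiallySkewAdjoint (⟨B, B.subtype ∘ₗ ρ x⟩ : H →ₗ.[ℂ] H)
  ρ_odd_symmetric : ∀ x ∈ S.alg.part 1,
    (Complex.exp (-(Real.pi * Complex.I / 4)) • ρ x : B →ₗ[ℂ] B).IsSymmetric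
  /-- Every coset `g₀ G°` of the identity component has a representative `g` with
  `π(g)⁻¹ B ⊆ B` and `π(g) ρ(x) π(g)⁻¹ = ρ(Ad(g) x)` for all odd `x`. -/
  conj_representative : ∀ g₀ : G, ∃ g : G, g₀⁻¹ * g ∈ connectedComponent (1 : G) ∧
    ∃ hB : ∀ v ∈ B, (π.toHom g)⁻¹ v ∈ B, ∀ x ∈ S.alg.part 1, ∀ v : B,
      π.toHom g (ρ x ⟨(π.toHom g)⁻¹ v, hB v v.2⟩) = (ρ (S.Ad g x) v : H)

namespace PreRepresentation

variable {E G 𝔤 : Type*}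
  [NormedAddCommGroup E] [NormedSpace ℝ E] [CompleteSpace E]
  [TopologicalSpace G] [T2Space G] [ChartedSpace E G] [Group G] [LieGroup 𝓘(ℝ, E) ω G]
  [NormedAddCommGroup 𝔤] [NormedSpace ℝ 𝔤] [CompleteSpace 𝔤]
  {S : BanachLieSupergroup E G 𝔤}
  {H : Type*} [NormedAddCommGroup H] [InnerProductSpace ℂ H] [CompleteSpace H]

/-- `ρ(x)` as an unbounded operator on `H` with domain `B`. -/
def op (P : PreRepresentation S H) (x : 𝔤) : H →ₗ.[ℂ] H := ⟨P.B, P.B.subtype ∘ₗ P.ρ x⟩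

/-- The operator `ρ̃(x)`, for `x = (a₀ + i b₀) + (a₁ + i b₁)` in the complexification of `𝔤`: the sum
`cl ρ(a₀) + i cl ρ(b₀) + cl ρ(a₁) + i cl ρ(b₁)` of the closures, restricted to the smooth vectors.
(As for all unbounded operators, the domain of a sum is the intersection of the domains; the claim
that the smooth vectors lie in it is made where `ρ̃` is used.) -/
def rhoTilde (P : PreRepresentation S H) (x : ℂ ⊗[ℝ] 𝔤) : H →ₗ.[ℂ] H :=
  ((P.op (S.alg.evenComponent (reC x))).closure
    + Complex.I • (P.op (S.alg.evenComponent (imC x))).closure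
    + (P.op (S.alg.oddComponent (reC x))).closure
    + Complex.I • (P.op (S.alg.oddComponent (imC x))).closure).domRestrict (P.π.smoothVectors E)

end PreRepresentation

end

/-! For odd `x`, write T(x) for the closure of ρ(x) restricted to smooth vectors (`oddAction`). On
`B` the symmetry of e^{-πi/4}ρ(x) and the relation 2ρ(x)² = ρ([x,x]) give ‖ρ(x)v‖² ≤ ‖v‖ ‖ρ([x,x])v‖
(`norm_ρ_odd_sq_le`). Since ρ([x,x]) is essentially skew-adjoint, its closure extends the generator
dπ([x,x]) (`generator_mem_closure_graph`). Hence smooth vectors lie in the domain of T(x), and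
‖T(x)v‖² ≤ C ‖x‖² ‖v‖ ‖dπ(·)v‖ (`exists_norm_oddAction_sq_le`). This quadratic estimate replaces the
continuity that ρ is not assumed to have. Pairing with `B` shows that T is linear in x and gives a
weak commutation relation with dπ(y) (`inner_generator_oddAction`).

Equivariance along a one-parameter group g_t = exp(tz) is a constancy argument: for w in `B`, the
function ⟨π(g_t)w, T(Ad(g_t)x)π(g_t)v⟩ has derivative zero by the commutation relation
(`oddAction_lieExp`). That t ↦ T(Ad(g_t)x)π(g_t)v is differentiable follows from the quadratic
estimate (`hasDerivAt_oddAction_zero`).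

To reach all of `G`, exp is shown to be strictly differentiable at 0 with derivative the identity in
the chart at 1. Its range is then a neighbourhood of 1, so it generates the connected group
(`closure_range_lieExp`). The complex case follows by taking real and imaginary parts. -/

noncomputable section

open Set Filter Topology
open scoped NNReal

/-! ### Partial derivatives of maps into a vector space -/

section
variable {EN N : Type*} [NormedAddCommGroup EN] [NormedSpace ℝ EN] [TopologicalSpace N] [ChartedSpace EN N]
  {E M : Type*} [NormedAddCommGroup E] [NormedSpace ℝ E] [TopologicalSpace M] [ChartedSpace E M]
  {F : Type*} [NormedAddCommGroup F] [NormedSpace ℝ F]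

/-- The derivative at `a` of a map from a manifold modelled on `E` to a vector space `F`, as a
continuous linear map from `E` to `F`. -/
def vderiv (E : Type*) [NormedAddCommGroup E] [NormedSpace ℝ E] {M : Type*} [TopologicalSpace M]
    [ChartedSpace E M] {F : Type*} [NormedAddCommGroup F] [NormedSpace ℝ F] (f : M → F) (a : M) : E →L[ℝ] F :=
  mfderiv 𝓘(ℝ, E) 𝓘(ℝ, F) f a

/-- Regularity of `mfderiv` in a parameter is available in tangent coordinates; with the base point
`a` fixed and a vector space as target, both coordinate changes are the identity. -/
theorem ContMDiffAt.vderiv_partial {m n : WithTop ℕ∞} [IsManifold 𝓘(ℝ, EN) n N] [IsManifold 𝓘(ℝ, E) n M]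
   {f : N → M → F} {x₀ : N} {a : M}
   (hf : ContMDiffAt (𝓘(ℝ, EN).prod 𝓘(ℝ, E)) 𝓘(ℝ, F) n (Function.uncurry f) (x₀, a)) (hmn : m + 1 ≤ n) :
   ContMDiffAt 𝓘(ℝ, EN) 𝓘(ℝ, E →L[ℝ] F) m (fun x => vderiv E (f x) a) x₀ := by
  have h1 : 1 ≤ n := le_trans le_add_self hmn
  have : IsManifold 𝓘(ℝ, EN) 1 N := IsManifold.of_le h1
  have : IsManifold 𝓘(ℝ, E) 1 M := IsManifold.of_le h1
  have h := hf.mfderiv (I := 𝓘(ℝ, E)) (I' := 𝓘(ℝ, F)) (J := 𝓘(ℝ, EN)) f (fun _ => a) contMDiffAt_const hmn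
  refine h.congr_of_eventuallyEq (Eventually.of_forall fun x => ?_)
  dsimp only
  have e := inTangentCoordinates_eq (I := 𝓘(ℝ, E)) (I' := 𝓘(ℝ, F)) (fun _ : N => a) (fun x => f x a)
    (fun x => vderiv E (f x) a) (x₀ := x₀) (x := x)
    (mem_chart_source E a) (mem_chart_source F (f x a))
  refine Eq.trans ?_ e.symm
  ext v
  rw [ContinuousLinearMap.comp_apply, ContinuousLinearMap.comp_apply,
    (tangentBundleCore 𝓘(ℝ, E) M).coordChange_self _ _ (mem_chart_source E a),
    tangentBundleCore_coordChange_model_space]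
  rfl
end

/-! ### One-parameter subgroups -/

section
variable {E : Type*} [NormedAddCommGroup E] [NormedSpace ℝ E] [CompleteSpace E]
  {G : Type*} [TopologicalSpace G] [T2Space G] [ChartedSpace E G] [Group G] [LieGroup 𝓘(ℝ, E) ω G]

omit [CompleteSpace E] [T2Space G] in
lemma contMDiff_mulInvariantVectorField_one (x : GroupLieAlgebra 𝓘(ℝ, E) G) :
    ContMDiff 𝓘(ℝ, E) 𝓘(ℝ, E).tangent 1
      (fun g : G => (mulInvariantVectorField x g : TangentBundle 𝓘(ℝ, E) G)) :=
  (contMDiff_mulInvariantVectorField x).of_le (le_trans (by norm_num) le_minSmoothness)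

/-- `lieExp (t • x)` is the time-one value of a curve chosen separately for each `t`; uniqueness of
integral curves identifies that curve with a rescaling of the one chosen for `x`. -/
lemma isMIntegralCurve_lieExp (x : GroupLieAlgebra 𝓘(ℝ, E) G) :
    IsMIntegralCurve (I := 𝓘(ℝ, E)) (fun t : ℝ => lieExp (G := G) (t • x)) (mulInvariantVectorField x) := by
  have : IsManifold 𝓘(ℝ, E) 1 G := IsManifold.of_le (n := ω) le_top
  obtain ⟨h0, h⟩ := (exists_leftInvariant_curve (G := G) x).choose_spec
  set γ := (exists_leftInvariant_curve (G := G) x).choose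
  convert h using 1
  ext t
  obtain ⟨h0', h'⟩ := (exists_leftInvariant_curve (G := G) (t • x)).choose_spec
  have e := isMIntegralCurve_Ioo_eq_of_contMDiff_boundaryless (t₀ := 0)
    (contMDiff_mulInvariantVectorField_one (t • x)) h'
    (mulInvariantVectorField_smul (I := 𝓘(ℝ, E)) t x ▸ h.comp_mul t) (by simp [h0, h0'])
  have e1 := congrFun e 1
  rw [Function.comp_apply, one_mul] at e1
  exact e1

@[simp] lemma lieExp_zero : lieExp (0 : GroupLieAlgebra 𝓘(ℝ, E) G) = 1 := by
  have : IsManifold 𝓘(ℝ, E) 1 G := IsManifold.of_le (n := ω) le_top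
  obtain ⟨h0, h⟩ := (exists_leftInvariant_curve (G := G) (0 : GroupLieAlgebra 𝓘(ℝ, E) G)).choose_spec
  have hc : IsMIntegralCurve (I := 𝓘(ℝ, E)) (fun _ : ℝ => (1 : G)) (mulInvariantVectorField 0) :=
    isMIntegralCurve_const ((mfderiv 𝓘(ℝ, E) 𝓘(ℝ, E) (fun y : G => 1 * y) 1).map_zero)
  exact congrFun (isMIntegralCurve_Ioo_eq_of_contMDiff_boundaryless (t₀ := 0)
    (contMDiff_mulInvariantVectorField_one 0) h hc h0) 1

lemma lieExp_add_smul (x : GroupLieAlgebra 𝓘(ℝ, E) G) (s t : ℝ) :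
    lieExp ((s + t) • x) = lieExp (s • x) * lieExp (t • x) := by
  have : IsManifold 𝓘(ℝ, E) 1 G := IsManifold.of_le (n := ω) le_top
  have h := isMIntegralCurve_lieExp (G := G) x
  have h1 := h.comp_add s
  have h2 : IsMIntegralCurve (I := 𝓘(ℝ, E)) (fun t : ℝ => lieExp (s • x) * lieExp (G := G) (t • x))
    (mulInvariantVectorField x) := by
    rw [isMIntegralCurve_iff_isMIntegralCurveOn] at h ⊢
    exact isMIntegralCurveOn_const_mul h _
  have e := isMIntegralCurve_Ioo_eq_of_contMDiff_boundaryless (t₀ := 0)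
    (contMDiff_mulInvariantVectorField_one x) h1 h2 (by simp)
  simpa [add_comm] using congrFun e t

omit [CompleteSpace E] [T2Space G] [LieGroup 𝓘(ℝ, E) ω G] in
lemma mulInvariantVectorField_one (x : GroupLieAlgebra 𝓘(ℝ, E) G) :
    mulInvariantVectorField (I := 𝓘(ℝ, E)) x (1 : G) = x := by
  have : (fun y : G => 1 * y) = id := by ext; simp
  rw [mulInvariantVectorField, this, mfderiv_id]
  rfl

lemma hasDerivAt_comp_lieExp {F : Type*} [NormedAddCommGroup F] [NormedSpace ℝ F] {f : G → F}
   (hf : MDifferentiableAt 𝓘(ℝ, E) 𝓘(ℝ, F) f 1) (x : GroupLieAlgebra 𝓘(ℝ, E) G) :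
   HasDerivAt (fun t : ℝ => f (lieExp (t • x))) (vderiv E f 1 x) 0 := by
  have e0 : lieExp ((0 : ℝ) • x) = (1 : G) := by simp
  have hf' : HasMFDerivAt 𝓘(ℝ, E) 𝓘(ℝ, F) f (lieExp ((0 : ℝ) • x))
      (mfderiv 𝓘(ℝ, E) 𝓘(ℝ, F) f (lieExp ((0 : ℝ) • x))) := by
    rw [← e0] at hf
    exact hf.hasMFDerivAt
  have h := hf'.comp (0 : ℝ) (isMIntegralCurve_lieExp (G := G) x 0)
  have h2 : HasFDerivAt (fun t : ℝ => f (lieExp (t • x)))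
      ((vderiv E f (lieExp ((0 : ℝ) • x))).comp ((1 : ℝ →L[ℝ] ℝ).smulRight
        (show E from mulInvariantVectorField (I := 𝓘(ℝ, E)) x (lieExp (G := G) ((0 : ℝ) • x))))) 0 :=
    hasMFDerivAt_iff_hasFDerivAt.mp h
  convert h2.hasDerivAt using 1
  have key : ∀ g : G, g = 1 → vderiv E f 1 x = ((vderiv E f g).comp ((1 : ℝ →L[ℝ] ℝ).smulRight
        (show E from mulInvariantVectorField (I := 𝓘(ℝ, E)) x g))) 1 := by
    rintro g rfl
    rw [mulInvariantVectorField_one]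
    exact congrArg _ (one_smul ℝ x).symm
  exact key _ e0
end

/-! ### Dependence of an ordinary differential equation on its parameter -/

section
variable {E : Type*} [NormedAddCommGroup E] [NormedSpace ℝ E]

open ODE in
/-- The Picard-Lindelöf theorem, with the information that the solution stays in the ball on which
the vector field is controlled. -/
theorem IsPicardLindelof.exists_mem_closedBall [CompleteSpace E] {f : ℝ → E → E} {tmin tmax : ℝ}
    {t₀ : Icc tmin tmax} {x₀ x : E} {a r L K : ℝ≥0}
    (hf : IsPicardLindelof f t₀ x₀ a r L K) (hx : x ∈ Metric.closedBall x₀ r) :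
    ∃ α : ℝ → E, α t₀ = x ∧ ∀ t ∈ Icc tmin tmax,
      HasDerivWithinAt α (f t (α t)) (Icc tmin tmax) t ∧ α t ∈ Metric.closedBall x₀ a := by
  obtain ⟨α, hα⟩ := FunSpace.exists_isFixedPt_next hf hx
  refine ⟨α.compProj, by rw [FunSpace.compProj_val, ← hα, FunSpace.next_apply₀], fun t ht =>
    ⟨?_, α.compProj_mem_closedBall hf.mul_max_le⟩⟩
  apply hasDerivWithinAt_picard_Icc t₀.2 hf.continuousOn_uncurry
    α.continuous_compProj.continuousOn (fun _ ht' => α.compProj_mem_closedBall hf.mul_max_le)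
    x ht |>.congr_of_mem _ ht
  intro t' ht'
  nth_rw 1 [← hα]
  rw [FunSpace.compProj_of_mem ht', FunSpace.next_apply]

variable {V : E → E →L[ℝ] E} {p : E} {K : ℝ≥0} {R : ℝ}

lemma norm_sub_id_le_of_lipschitz (hV : LipschitzOnWith K V (Metric.closedBall p R))
    (hp : V p = ContinuousLinearMap.id ℝ E) (hR : 0 < R) {u : E} (hu : u ∈ Metric.closedBall p R) :
    ‖V u - ContinuousLinearMap.id ℝ E‖ ≤ K * ‖u - p‖ := by
  have h := hV.dist_le_mul u hu p (Metric.mem_closedBall_self hR.le)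
  rwa [dist_eq_norm, dist_eq_norm, hp] at h

lemma norm_apply_le_two_mul (hV : LipschitzOnWith K V (Metric.closedBall p R))
    (hp : V p = ContinuousLinearMap.id ℝ E) (hR : 0 < R) (hKR : K * R ≤ 1) {u : E}
    (hu : u ∈ Metric.closedBall p R) (x : E) : ‖V u x‖ ≤ 2 * ‖x‖ := by
  have h1 : ‖V u - ContinuousLinearMap.id ℝ E‖ ≤ 1 := by
    refine (norm_sub_id_le_of_lipschitz hV hp hR hu).trans (le_trans ?_ hKR)
    gcongr
    rwa [Metric.mem_closedBall, dist_eq_norm] at hu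
  calc ‖V u x‖ = ‖(V u - ContinuousLinearMap.id ℝ E) x + x‖ := by simp
    _ ≤ ‖(V u - ContinuousLinearMap.id ℝ E) x‖ + ‖x‖ := norm_add_le _ _
    _ ≤ 1 * ‖x‖ + ‖x‖ := by gcongr; exact ContinuousLinearMap.le_of_opNorm_le _ h1 x
    _ = 2 * ‖x‖ := by ring

/-- Solutions of `α' = V(α) x` for small `x`, on the time interval `[-2, 2]`. -/
theorem exists_curve_of_lipschitz [CompleteSpace E] (hV : LipschitzOnWith K V (Metric.closedBall p R))
    (hp : V p = ContinuousLinearMap.id ℝ E) (hR : 0 < R) (hKR : K * R ≤ 1) {x : E} (hx : ‖x‖ ≤ R / 8) :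
    ∃ α : ℝ → E, α 0 = p ∧ ∀ t ∈ Icc (-2 : ℝ) 2,
      HasDerivWithinAt α (V (α t) x) (Icc (-2) 2) t ∧ α t ∈ Metric.closedBall p R := by
  -- Speed at most `R / 2` for time 2 keeps the solution in the ball of radius `R`. The interval
  -- reaches beyond 1 so that time 1 is an interior point.
  have hPL : IsPicardLindelof (fun _ u => V u x) (tmin := -2) (tmax := 2) ⟨0, by simp⟩ p
      ⟨R, hR.le⟩ 0 ⟨R / 2, by positivity⟩ (K * ‖x‖₊) := by
    refine IsPicardLindelof.of_time_independent (fun u hu => ?_) ?_ ?_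
    · refine (norm_apply_le_two_mul hV hp hR hKR hu x).trans ?_
      change _ ≤ R / 2
      linarith
    · refine LipschitzOnWith.of_dist_le_mul fun u hu w hw => ?_
      have h := hV.dist_le_mul u hu w hw
      rw [dist_eq_norm] at h
      rw [dist_eq_norm, ← sub_apply]
      refine (ContinuousLinearMap.le_of_opNorm_le _ h x).trans (le_of_eq ?_)
      push_cast
      ring
    · change R / 2 * max (2 - 0) (0 - -2) ≤ R - 0
      norm_num
  exact hPL.exists_mem_closedBall (Metric.mem_closedBall_self (by simp))

/-- The endpoint of the solution of `α' = V(α) x` depends on the parameter `x` almost like `x`. -/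
theorem norm_endpoint_sub_le (hV : LipschitzOnWith K V (Metric.closedBall p R))
    (hp : V p = ContinuousLinearMap.id ℝ E) (hR : 0 < R) (hKR : K * R ≤ 1) {x y : E}
    (hy : ‖y‖ ≤ R) {α β : ℝ → E} (hα0 : α 0 = p) (hβ0 : β 0 = p)
    (hα : ∀ t ∈ Icc (0 : ℝ) 1, HasDerivWithinAt α (V (α t) x) (Icc 0 1) t ∧
      α t ∈ Metric.closedBall p R)
    (hβ : ∀ t ∈ Icc (0 : ℝ) 1, HasDerivWithinAt β (V (β t) y) (Icc 0 1) t ∧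
      β t ∈ Metric.closedBall p R) :
    ‖α 1 - β 1 - (x - y)‖ ≤ 2 * (K * (2 * ‖x‖ + ‖y‖) * ‖x - y‖) := by
  have hright : ∀ {f : ℝ → E} {f' : E} {t : ℝ}, t ∈ Ico (0 : ℝ) 1 →
      HasDerivWithinAt f f' (Icc 0 1) t → HasDerivWithinAt f f' (Ici t) t := fun ht h =>
    h.mono_of_mem_nhdsWithin
      (mem_of_superset (Icc_mem_nhdsGE ht.2) (Icc_subset_Icc_left ht.1))
  have hαp : ∀ t ∈ Icc (0 : ℝ) 1, ‖α t - p‖ ≤ 2 * ‖x‖ := by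
    intro t ht
    have h := norm_image_sub_le_of_norm_deriv_right_le_segment
      (fun t ht => (hα t ht).1.continuousWithinAt)
      (fun t ht => hright ht (hα t (Ico_subset_Icc_self ht)).1)
      (fun t ht => norm_apply_le_two_mul hV hp hR hKR (hα t (Ico_subset_Icc_self ht)).2 x) t ht
    rw [hα0] at h
    refine h.trans ?_
    have := ht.2
    have := norm_nonneg x
    nlinarith
  -- Gronwall is applied to the deviation of `α - β` from the motion it would have if `V` were
  -- constantly the identity.
  set δ : ℝ → E := fun t => α t - β t - t • (x - y)
  have hδ : ∀ t ∈ Icc (0 : ℝ) 1, HasDerivWithinAt δ (V (α t) x - V (β t) y - (x - y)) (Icc 0 1) t := by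
    intro t ht
    have h := ((hα t ht).1.sub (hβ t ht).1).sub ((hasDerivWithinAt_id t _).smul_const (x - y))
    rw [one_smul] at h
    exact h
  have hbound : ∀ t ∈ Ico (0 : ℝ) 1, ‖V (α t) x - V (β t) y - (x - y)‖ ≤
      1 * ‖δ t‖ + K * (2 * ‖x‖ + ‖y‖) * ‖x - y‖ := by
    intro t ht
    have ht' := Ico_subset_Icc_self ht
    have e : V (α t) x - V (β t) y - (x - y)
        = (V (α t) - ContinuousLinearMap.id ℝ E) (x - y) + (V (α t) - V (β t)) y := by
      simp; abel
    have h1 : ‖(V (α t) - ContinuousLinearMap.id ℝ E) (x - y)‖ ≤ K * (2 * ‖x‖) * ‖x - y‖ := by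
      refine ContinuousLinearMap.le_of_opNorm_le _ ?_ _
      refine (norm_sub_id_le_of_lipschitz hV hp hR (hα t ht').2).trans ?_
      gcongr
      exact hαp t ht'
    have h2 : ‖(V (α t) - V (β t)) y‖ ≤ K * ‖α t - β t‖ * ‖y‖ := by
      refine ContinuousLinearMap.le_of_opNorm_le _ ?_ _
      have := hV.dist_le_mul _ (hα t ht').2 _ (hβ t ht').2
      rwa [dist_eq_norm, dist_eq_norm] at this
    have h3 : ‖α t - β t‖ ≤ ‖δ t‖ + ‖x - y‖ := by
      calc ‖α t - β t‖ = ‖δ t + t • (x - y)‖ := by simp [δ]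
        _ ≤ ‖δ t‖ + ‖t • (x - y)‖ := norm_add_le _ _
        _ ≤ ‖δ t‖ + 1 * ‖x - y‖ := by
          rw [norm_smul, Real.norm_eq_abs, abs_of_nonneg ht.1]
          gcongr
          exact ht.2.le
        _ = _ := by ring
    -- This makes the Gronwall rate equal to 1, independently of `K`.
    have h4 : (K : ℝ) * ‖y‖ ≤ 1 := le_trans (by gcongr) hKR
    have h5 := norm_nonneg (δ t)
    have h6 : (K : ℝ) * ‖α t - β t‖ * ‖y‖ ≤ ‖δ t‖ + K * ‖y‖ * ‖x - y‖ := by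
      calc (K : ℝ) * ‖α t - β t‖ * ‖y‖ ≤ K * (‖δ t‖ + ‖x - y‖) * ‖y‖ := by gcongr
        _ = K * ‖y‖ * ‖δ t‖ + K * ‖y‖ * ‖x - y‖ := by ring
        _ ≤ 1 * ‖δ t‖ + K * ‖y‖ * ‖x - y‖ := by gcongr
        _ = _ := by ring
    rw [e]
    refine (norm_add_le _ _).trans ?_
    nlinarith
  have h := norm_le_gronwallBound_of_norm_deriv_right_le (δ := 0)
    (fun t ht => (hδ t ht).continuousWithinAt)
    (fun t ht => hright ht (hδ t (Ico_subset_Icc_self ht))) (by simp [δ, hα0, hβ0]) hbound 1 (by simp)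
  rw [gronwallBound_of_K_ne_0 one_ne_zero] at h
  simp only [δ, one_smul, sub_zero, mul_one, zero_mul, div_one, zero_add] at h
  refine h.trans ?_
  rw [mul_comm]
  gcongr
  -- The Gronwall factor at time 1 is e - 1 < 2.
  linarith [Real.exp_one_lt_d9]
end

/-! ### The exponential map in the chart at the identity; generation of a connected group -/

section
variable {E : Type*} [NormedAddCommGroup E] [NormedSpace ℝ E]
  {G : Type*} [TopologicalSpace G] [ChartedSpace E G] [Group G] [LieGroup 𝓘(ℝ, E) ω G]

variable (E G) in
/-- The left-invariant vector fields in the chart at the identity: `chartField E G u x` is the value at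
the point with coordinate `u` of the left-invariant vector field generated by `x`. -/
def chartField (u : E) : E →L[ℝ] E :=
  vderiv E (fun h : G => extChartAt 𝓘(ℝ, E) (1 : G) ((extChartAt 𝓘(ℝ, E) (1 : G)).symm u * h)) 1

omit [LieGroup 𝓘(ℝ, E) ω G] in
lemma extChartAt_target_mem_nhds_one :
    (extChartAt 𝓘(ℝ, E) (1 : G)).target ∈ 𝓝 (extChartAt 𝓘(ℝ, E) (1 : G) 1) :=
  extChartAt_target_mem_nhds (I := 𝓘(ℝ, E)) (1 : G)

lemma contMDiffAt_chart_mul {u : E} (hu : u ∈ (extChartAt 𝓘(ℝ, E) (1 : G)).target) :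
    ContMDiffAt (𝓘(ℝ, E).prod 𝓘(ℝ, E)) 𝓘(ℝ, E) ω (Function.uncurry fun (u : E) (h : G) =>
      extChartAt 𝓘(ℝ, E) (1 : G) ((extChartAt 𝓘(ℝ, E) (1 : G)).symm u * h)) (u, 1) := by
  have : IsManifold 𝓘(ℝ, E) ω G := IsManifold.of_le (n := ω) le_rfl
  have h1 : ContMDiffAt 𝓘(ℝ, E) 𝓘(ℝ, E) ω (extChartAt 𝓘(ℝ, E) (1 : G))
      ((extChartAt 𝓘(ℝ, E) (1 : G)).symm u * 1) := by
    apply contMDiffAt_extChartAt'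
    rw [mul_one, ← extChartAt_source 𝓘(ℝ, E)]
    exact (extChartAt 𝓘(ℝ, E) (1 : G)).map_target hu
  have h2 : ContMDiffAt 𝓘(ℝ, E) 𝓘(ℝ, E) ω (extChartAt 𝓘(ℝ, E) (1 : G)).symm u :=
    (contMDiffOn_extChartAt_symm (1 : G)).contMDiffAt ((isOpen_extChartAt_target (1 : G)).mem_nhds hu)
  have h3 : ContMDiffAt (𝓘(ℝ, E).prod 𝓘(ℝ, E)) 𝓘(ℝ, E) ω
      (fun q : E × G => (extChartAt 𝓘(ℝ, E) (1 : G)).symm q.1 * q.2) (u, 1) :=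
    (h2.comp (u, (1 : G)) contMDiffAt_fst).mul contMDiffAt_snd
  exact h1.comp (u, (1 : G)) h3

lemma contDiffAt_chartField :
    ContDiffAt ℝ 1 (chartField E G) (extChartAt 𝓘(ℝ, E) (1 : G) 1) := by
  have : IsManifold 𝓘(ℝ, E) ω G := IsManifold.of_le (n := ω) le_rfl
  rw [← contMDiffAt_iff_contDiffAt]
  exact (contMDiffAt_chart_mul (mem_of_mem_nhds extChartAt_target_mem_nhds_one)).vderiv_partial
    (n := ω) le_top

/-- At the identity the map being differentiated is the chart itself, whose derivative at its own
base point is the identity in tangent coordinates. -/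
lemma chartField_one :
    chartField E G (extChartAt 𝓘(ℝ, E) (1 : G) 1) = ContinuousLinearMap.id ℝ E := by
  have : IsManifold 𝓘(ℝ, E) 1 G := IsManifold.of_le (n := ω) le_top
  have e : (fun h : G => extChartAt 𝓘(ℝ, E) (1 : G) ((extChartAt 𝓘(ℝ, E) (1 : G)).symm
      (extChartAt 𝓘(ℝ, E) (1 : G) 1) * h)) = chartAt E (1 : G) := by
    ext h
    rw [extChartAt_to_inv, one_mul]
    rfl
  rw [chartField, e, vderiv, mfderiv_chartAt_eq_tangentCoordChange (mem_chart_source E (1 : G))]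
  ext v
  exact tangentCoordChange_self (mem_extChartAt_source (1 : G))

/-- Near 1, left translation by the point with coordinate `u` factors through the chart, so the
chain rule applies. This lets solutions in the chart be pushed forward to integral curves in `G`. -/
lemma mfderiv_symm_chartField {u : E} (hu : u ∈ (extChartAt 𝓘(ℝ, E) (1 : G)).target)
    (x : GroupLieAlgebra 𝓘(ℝ, E) G) :
    MDifferentiableAt 𝓘(ℝ, E) 𝓘(ℝ, E) (extChartAt 𝓘(ℝ, E) (1 : G)).symm u ∧
    mfderiv 𝓘(ℝ, E) 𝓘(ℝ, E) (extChartAt 𝓘(ℝ, E) (1 : G)).symm u (chartField E G u x)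
      = mulInvariantVectorField (I := 𝓘(ℝ, E)) x ((extChartAt 𝓘(ℝ, E) (1 : G)).symm u) := by
  have : IsManifold 𝓘(ℝ, E) ω G := IsManifold.of_le (n := ω) le_rfl
  set φ := extChartAt 𝓘(ℝ, E) (1 : G)
  have h2 : MDifferentiableAt 𝓘(ℝ, E) 𝓘(ℝ, E) φ.symm u :=
    ((contMDiffOn_extChartAt_symm (n := ω) (1 : G)).contMDiffAt
      ((isOpen_extChartAt_target (1 : G)).mem_nhds hu)).mdifferentiableAt (by simp)
  refine ⟨h2, ?_⟩
  set g := φ.symm u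
  have hu' : φ (g * 1) = u := by rw [mul_one]; exact φ.right_inv hu
  have h3 : MDifferentiableAt 𝓘(ℝ, E) 𝓘(ℝ, E) (fun h : G => φ (g * h)) 1 := by
    have h := (contMDiffAt_chart_mul hu).comp (1 : G)
      (contMDiffAt_const.prodMk contMDiffAt_id : ContMDiffAt 𝓘(ℝ, E) (𝓘(ℝ, E).prod 𝓘(ℝ, E)) ω
        (fun h : G => (u, h)) 1)
    exact h.mdifferentiableAt (by simp)
  have h4 : (fun h : G => g * h) =ᶠ[𝓝 1] φ.symm ∘ fun h : G => φ (g * h) := by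
    have hc : ContinuousAt (fun h : G => g * h) 1 :=
      ((contMDiff_mul_left (I := 𝓘(ℝ, E)) (n := ω)).continuous).continuousAt
    have hs : φ.source ∈ 𝓝 (g * 1) := by
      rw [mul_one]
      exact (isOpen_extChartAt_source (1 : G)).mem_nhds (φ.map_target hu)
    filter_upwards [hc hs] with h hh
    exact (φ.left_inv hh).symm
  rw [mulInvariantVectorField, h4.mfderiv_eq]
  exact (mfderiv_comp_apply_of_eq 1 h2 h3 hu' x).symm

variable [CompleteSpace E] [T2Space G]

lemma lieExp_eq_of_curve {α : ℝ → E} {x : GroupLieAlgebra 𝓘(ℝ, E) G}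
    (h0 : α 0 = extChartAt 𝓘(ℝ, E) (1 : G) 1)
    (hα : ∀ t ∈ Ioo (-2 : ℝ) 2, HasDerivAt α (chartField E G (α t) x) t ∧
      α t ∈ (extChartAt 𝓘(ℝ, E) (1 : G)).target) :
    lieExp x = (extChartAt 𝓘(ℝ, E) (1 : G)).symm (α 1) := by
  have : IsManifold 𝓘(ℝ, E) 1 G := IsManifold.of_le (n := ω) le_top
  have hγ : IsMIntegralCurveOn (I := 𝓘(ℝ, E)) ((extChartAt 𝓘(ℝ, E) (1 : G)).symm ∘ α)
      (mulInvariantVectorField x) (Ioo (-2) 2) := by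
    intro t ht
    obtain ⟨h1, h2⟩ := mfderiv_symm_chartField (hα t ht).2 x
    have h3 := h1.hasMFDerivAt.comp t (hα t ht).1.hasFDerivAt.hasMFDerivAt
    have e : (1 : ℝ →L[ℝ] ℝ).smulRight (mulInvariantVectorField (I := 𝓘(ℝ, E)) x
          ((extChartAt 𝓘(ℝ, E) (1 : G)).symm (α t)))
        = (mfderiv 𝓘(ℝ, E) 𝓘(ℝ, E) (extChartAt 𝓘(ℝ, E) (1 : G)).symm (α t)).comp
          (ContinuousLinearMap.toSpanSingleton ℝ (chartField E G (α t) x)) := by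
      rw [← h2]
      exact ContinuousLinearMap.ext fun r => (ContinuousLinearMap.map_smul _ _ _).symm
    exact (e ▸ h3).hasMFDerivWithinAt
  have h := (isMIntegralCurve_lieExp (G := G) x).isMIntegralCurveOn (Ioo (-2) 2)
  have e := isMIntegralCurveOn_Ioo_eqOn_of_contMDiff_boundaryless (t₀ := 0) (by simp)
    (contMDiff_mulInvariantVectorField_one x) h hγ (by simp [h0]) (show (1 : ℝ) ∈ _ by simp; norm_num)
  simpa using e


/-- Quantitative form of the strict differentiability at `0` of the exponential map, read in the chart
at the identity. -/
theorem exists_lieExp_chart_estimate : ∃ K : ℝ≥0, ∃ r : ℝ, 0 < r ∧ ∀ x : E, ‖x‖ ≤ r →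
    lieExp (x : GroupLieAlgebra 𝓘(ℝ, E) G) ∈ (extChartAt 𝓘(ℝ, E) (1 : G)).source ∧
    ∀ y : E, ‖y‖ ≤ r →
      ‖extChartAt 𝓘(ℝ, E) (1 : G) (lieExp (x : GroupLieAlgebra 𝓘(ℝ, E) G))
        - extChartAt 𝓘(ℝ, E) (1 : G) (lieExp (y : GroupLieAlgebra 𝓘(ℝ, E) G)) - (x - y)‖
        ≤ 2 * (K * (2 * ‖x‖ + ‖y‖) * ‖x - y‖) := by
  set p := extChartAt 𝓘(ℝ, E) (1 : G) 1
  obtain ⟨K, s, hs, hK⟩ := (contDiffAt_chartField (E := E) (G := G)).exists_lipschitzOnWith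
  obtain ⟨R₀, hR₀, hsub⟩ := Metric.nhds_basis_closedBall.mem_iff.mp
    (inter_mem hs (extChartAt_target_mem_nhds_one (E := E) (G := G)))
  obtain ⟨R, hR, hRR₀, hKR⟩ : ∃ R : ℝ, 0 < R ∧ R ≤ R₀ ∧ K * R ≤ 1 := by
    -- The `+ 1` covers the case `K = 0`.
    refine ⟨min R₀ (1 / (K + 1)), by positivity, min_le_left _ _, ?_⟩
    calc (K : ℝ) * min R₀ (1 / (K + 1)) ≤ K * (1 / (K + 1)) := by gcongr; exact min_le_right _ _
      _ ≤ 1 := by rw [mul_one_div, div_le_one (by positivity)]; linarith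
  have hball := Metric.closedBall_subset_closedBall (x := p) hRR₀
  have hV : LipschitzOnWith K (chartField E G) (Metric.closedBall p R) :=
    hK.mono fun u hu => (hsub (hball hu)).1
  have hmain : ∀ x : E, ‖x‖ ≤ R / 8 → ∃ α : ℝ → E, α 0 = p ∧ (∀ t ∈ Icc (0 : ℝ) 1,
      HasDerivWithinAt α (chartField E G (α t) x) (Icc 0 1) t ∧ α t ∈ Metric.closedBall p R) ∧
      lieExp (G := G) (x : GroupLieAlgebra 𝓘(ℝ, E) G) = (extChartAt 𝓘(ℝ, E) (1 : G)).symm (α 1) := by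
    intro x hx
    obtain ⟨α, h0, hα⟩ := exists_curve_of_lipschitz hV chartField_one hR hKR hx
    have hsub' : Icc (0 : ℝ) 1 ⊆ Icc (-2) 2 := Icc_subset_Icc (by norm_num) (by norm_num)
    refine ⟨α, h0, fun t ht => ⟨(hα t (hsub' ht)).1.mono hsub', (hα t (hsub' ht)).2⟩, ?_⟩
    refine lieExp_eq_of_curve h0 fun t ht => ?_
    obtain ⟨h1, h2⟩ := hα t (Ioo_subset_Icc_self ht)
    exact ⟨h1.hasDerivAt (Icc_mem_nhds ht.1 ht.2), (hsub (hball h2)).2⟩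
  refine ⟨K, R / 8, by positivity, fun x hx => ?_⟩
  obtain ⟨α, hα0, hα, eα⟩ := hmain x hx
  have hαt : α 1 ∈ (extChartAt 𝓘(ℝ, E) (1 : G)).target := (hsub (hball (hα 1 (by simp)).2)).2
  refine ⟨eα ▸ (extChartAt 𝓘(ℝ, E) (1 : G)).map_target hαt, fun y hy => ?_⟩
  obtain ⟨β, hβ0, hβ, eβ⟩ := hmain y hy
  have hβt : β 1 ∈ (extChartAt 𝓘(ℝ, E) (1 : G)).target := (hsub (hball (hβ 1 (by simp)).2)).2
  rw [eα, eβ, (extChartAt 𝓘(ℝ, E) (1 : G)).right_inv hαt, (extChartAt 𝓘(ℝ, E) (1 : G)).right_inv hβt]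
  have hy' : ‖(y : E)‖ ≤ R := by
    have : ‖(y : E)‖ ≤ R / 8 := hy
    linarith
  exact norm_endpoint_sub_le hV chartField_one hR hKR hy' hα0 hβ0 hα hβ

theorem hasStrictFDerivAt_lieExp :
    HasStrictFDerivAt (fun x : E => extChartAt 𝓘(ℝ, E) (1 : G)
      (lieExp (x : GroupLieAlgebra 𝓘(ℝ, E) G))) (ContinuousLinearMap.id ℝ E) 0 := by
  obtain ⟨K, r, hr, h⟩ := exists_lieExp_chart_estimate (E := E) (G := G)
  refine .of_isLittleO (Asymptotics.isLittleO_iff.mpr fun c hc => ?_)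
  -- If both norms are at most ε, the error constant 2K(2‖x‖ + ‖y‖) is at most 6Kε; this choice of ε
  -- makes it at most `c`.
  have hc' : 0 < min r (c / (6 * K + 1)) := by positivity
  filter_upwards [Metric.ball_mem_nhds ((0 : E), (0 : E)) hc'] with q hq
  rw [Metric.mem_ball, dist_eq_norm, show q - ((0 : E), (0 : E)) = q by ext <;> simp] at hq
  have hx : ‖q.1‖ ≤ min r (c / (6 * K + 1)) := (norm_fst_le q).trans hq.le
  have hy : ‖q.2‖ ≤ min r (c / (6 * K + 1)) := (norm_snd_le q).trans hq.le
  refine ((h q.1 (hx.trans (min_le_left _ _))).2 q.2 (hy.trans (min_le_left _ _))).trans ?_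
  have hx2 : ‖q.1‖ ≤ c / (6 * K + 1) := hx.trans (min_le_right _ _)
  have hy2 : ‖q.2‖ ≤ c / (6 * K + 1) := hy.trans (min_le_right _ _)
  have : 2 * ((K : ℝ) * (2 * ‖q.1‖ + ‖q.2‖)) ≤ c := by
    calc 2 * ((K : ℝ) * (2 * ‖q.1‖ + ‖q.2‖))
        ≤ 2 * ((K : ℝ) * (2 * (c / (6 * K + 1)) + c / (6 * K + 1))) := by gcongr
      _ = c * (6 * K / (6 * K + 1)) := by ring
      _ ≤ c * 1 := by
        gcongr
        rw [div_le_one (by positivity)]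
        linarith
      _ = c := mul_one c
  calc 2 * ((K : ℝ) * (2 * ‖q.1‖ + ‖q.2‖) * ‖q.1 - q.2‖)
      = 2 * ((K : ℝ) * (2 * ‖q.1‖ + ‖q.2‖)) * ‖q.1 - q.2‖ := by ring
    _ ≤ c * ‖q.1 - q.2‖ := by gcongr

/-- By the inverse function theorem, exp read in the chart sends a small ball to a neighbourhood.
Since exp of that ball stays in the chart's source, injectivity of the chart brings the statement
back to `G`. -/
theorem range_lieExp_mem_nhds_one :
    range (lieExp : GroupLieAlgebra 𝓘(ℝ, E) G → G) ∈ 𝓝 (1 : G) := by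
  obtain ⟨K, r, hr, h⟩ := exists_lieExp_chart_estimate (E := E) (G := G)
  have hmap := HasStrictFDerivAt.map_nhds_eq_of_equiv (f' := ContinuousLinearEquiv.refl ℝ E)
    (hasStrictFDerivAt_lieExp (E := E) (G := G))
  have h0 : lieExp (G := G) ((0 : E) : GroupLieAlgebra 𝓘(ℝ, E) G) = 1 := lieExp_zero
  rw [h0] at hmap
  have himg := hmap ▸ image_mem_map (Metric.closedBall_mem_nhds (0 : E) hr)
  have hc := (continuousAt_extChartAt (I := 𝓘(ℝ, E)) (1 : G)).preimage_mem_nhds himg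
  filter_upwards [hc, extChartAt_source_mem_nhds (I := 𝓘(ℝ, E)) (1 : G)] with g hg hgs
  obtain ⟨x, hx, e⟩ := hg
  have hx' : ‖x‖ ≤ r := by simpa using hx
  exact ⟨x, (extChartAt 𝓘(ℝ, E) (1 : G)).injOn (h x hx').1 hgs e⟩

/-- A subgroup containing a neighbourhood of 1 is open, hence also closed, hence everything when `G`
is connected. -/
theorem closure_range_lieExp [ConnectedSpace G] :
    Subgroup.closure (range (lieExp : GroupLieAlgebra 𝓘(ℝ, E) G → G)) = ⊤ := by
  have : IsTopologicalGroup G := topologicalGroup_of_lieGroup 𝓘(ℝ, E) ω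
  set N := Subgroup.closure (range (lieExp : GroupLieAlgebra 𝓘(ℝ, E) G → G))
  have ho : IsOpen (N : Set G) := N.isOpen_of_mem_nhds
    (mem_of_superset (range_lieExp_mem_nhds_one (E := E)) Subgroup.subset_closure)
  have hclopen : IsClopen (N : Set G) := ⟨N.isClosed_of_isOpen ho, ho⟩
  exact SetLike.coe_injective (hclopen.eq_univ ⟨1, N.one_mem⟩)
end

/-! ### Smooth vectors and generators -/

namespace UnitaryRepresentation
variable {E : Type*} [NormedAddCommGroup E] [NormedSpace ℝ E]
  {G : Type*} [TopologicalSpace G] [ChartedSpace E G] [Group G]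
  {H : Type*} [NormedAddCommGroup H] [InnerProductSpace ℂ H]

variable (E) in
/-- The derivative at the identity of the orbit map of `v`. -/
def orbitDeriv (π : UnitaryRepresentation G H) (v : H) : E →L[ℝ] H :=
  vderiv E (fun g : G => π.toHom g v) 1

lemma mem_smoothVectors {π : UnitaryRepresentation G H} {v : H} :
    v ∈ π.smoothVectors E ↔ ContMDiff 𝓘(ℝ, E) 𝓘(ℝ, H) ∞ fun g : G => π.toHom g v := Iff.rfl

lemma toHom_mul_apply (π : UnitaryRepresentation G H) (g h : G) (v : H) :
    π.toHom (g * h) v = π.toHom g (π.toHom h v) := by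
  rw [map_mul]; rfl

lemma toHom_inv_apply (π : UnitaryRepresentation G H) (g : G) (v : H) :
    (π.toHom g)⁻¹ v = π.toHom g⁻¹ v := by
  rw [map_inv]

lemma toHom_one_apply (π : UnitaryRepresentation G H) (v : H) : π.toHom 1 v = v := by
  rw [map_one]; rfl

variable [LieGroup 𝓘(ℝ, E) ω G]

lemma toHom_mem_smoothVectors (π : UnitaryRepresentation G H) {v : H} (hv : v ∈ π.smoothVectors E)
    (g : G) : π.toHom g v ∈ π.smoothVectors E := by
  have h := (mem_smoothVectors.mp hv).comp
    ((contMDiff_mul_right (I := 𝓘(ℝ, E)) (n := ω) (a := g)).of_le le_top)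
  refine mem_smoothVectors.mpr (h.congr fun k => ?_)
  exact (π.toHom_mul_apply k g v).symm

/-- The map (g, h) ↦ π(h)π(g)v = π(hg)v is jointly smooth; its partial derivative in h at 1 is
smooth in g, as an operator-valued map. -/
lemma contMDiff_orbitDeriv (π : UnitaryRepresentation G H) {v : H} (hv : v ∈ π.smoothVectors E) :
    ContMDiff 𝓘(ℝ, E) 𝓘(ℝ, E →L[ℝ] H) ∞ fun g : G => π.orbitDeriv E (π.toHom g v) := by
  have : IsManifold 𝓘(ℝ, E) ∞ G := IsManifold.of_le (n := ω) le_top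
  intro g
  refine ContMDiffAt.vderiv_partial (n := ∞) (f := fun g h : G => π.toHom h (π.toHom g v)) ?_ (by simp)
  have h1 : ContMDiff (𝓘(ℝ, E).prod 𝓘(ℝ, E)) 𝓘(ℝ, E) ∞ (fun q : G × G => q.2 * q.1) :=
    (contMDiff_snd.mul contMDiff_fst : ContMDiff _ _ ω _).of_le le_top
  refine ContMDiff.contMDiffAt (((mem_smoothVectors.mp hv).comp h1).congr fun q => ?_)
  exact (π.toHom_mul_apply q.2 q.1 v).symm

variable [CompleteSpace E] [T2Space G]

lemma hasDerivAt_toHom_lieExp (π : UnitaryRepresentation G H) {v : H} (hv : v ∈ π.smoothVectors E)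
    (y : GroupLieAlgebra 𝓘(ℝ, E) G) :
    HasDerivAt (fun t : ℝ => π.toHom (lieExp (t • y)) v) (π.orbitDeriv E v y) 0 :=
  hasDerivAt_comp_lieExp (f := fun g => π.toHom g v)
    ((mem_smoothVectors.mp hv).mdifferentiableAt (by simp)) y

lemma mem_generator_domain (π : UnitaryRepresentation G H) {v : H} (hv : v ∈ π.smoothVectors E)
    (y : GroupLieAlgebra 𝓘(ℝ, E) G) : v ∈ (π.generator y).domain :=
  (π.hasDerivAt_toHom_lieExp hv y).differentiableAt

lemma generator_apply (π : UnitaryRepresentation G H) {v : H} (hv : v ∈ π.smoothVectors E)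
    (y : GroupLieAlgebra 𝓘(ℝ, E) G) :
    π.generator y ⟨v, π.mem_generator_domain hv y⟩ = π.orbitDeriv E v y :=
  (π.hasDerivAt_toHom_lieExp hv y).deriv

lemma hasDerivAt_generator (π : UnitaryRepresentation G H) (y : GroupLieAlgebra 𝓘(ℝ, E) G)
    (v : (π.generator y).domain) :
    HasDerivAt (fun t : ℝ => π.toHom (lieExp (t • y)) (v : H)) (π.generator y v) 0 :=
  DifferentiableAt.hasDerivAt v.2

/-- By unitarity ⟨π(exp ty)v, π(exp ty)w⟩ is constant; differentiate it at 0. -/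
lemma inner_generator (π : UnitaryRepresentation G H) (y : GroupLieAlgebra 𝓘(ℝ, E) G)
    (v w : (π.generator y).domain) :
    ⟪π.generator y v, (w : H)⟫_ℂ = -⟪(v : H), π.generator y w⟫_ℂ := by
  have h := (π.hasDerivAt_generator y v).inner ℂ (π.hasDerivAt_generator y w)
  have hc : (fun t : ℝ => ⟪π.toHom (lieExp (t • y)) (v : H), π.toHom (lieExp (t • y)) (w : H)⟫_ℂ)
      = fun _ => ⟪(v : H), (w : H)⟫_ℂ := by
    ext t
    exact LinearIsometryEquiv.inner_map_map _ _ _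
  rw [hc] at h
  have e := h.unique (hasDerivAt_const (0 : ℝ) _)
  simp only [zero_smul, lieExp_zero, toHom_one_apply] at e
  exact eq_neg_of_add_eq_zero_right e

/-- π(g)dπ(y)v is the derivative of h ↦ π(gh)v at h = 1 in direction y, and this partial derivative
is smooth in g. -/
lemma orbitDeriv_mem_smoothVectors (π : UnitaryRepresentation G H) {v : H}
    (hv : v ∈ π.smoothVectors E) (y : GroupLieAlgebra 𝓘(ℝ, E) G) :
    π.orbitDeriv E v y ∈ π.smoothVectors E := by
  have : IsManifold 𝓘(ℝ, E) ∞ G := IsManifold.of_le (n := ω) le_top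
  have hf : ∀ g : G, ContMDiffAt (𝓘(ℝ, E).prod 𝓘(ℝ, E)) 𝓘(ℝ, H) ∞
      (Function.uncurry fun g h : G => π.toHom g (π.toHom h v)) (g, 1) := by
    intro g
    have h1 : ContMDiff (𝓘(ℝ, E).prod 𝓘(ℝ, E)) 𝓘(ℝ, E) ∞ (fun q : G × G => q.1 * q.2) :=
      (contMDiff_fst.mul contMDiff_snd : ContMDiff _ _ ω _).of_le le_top
    refine ContMDiff.contMDiffAt (((mem_smoothVectors.mp hv).comp h1).congr fun q => ?_)
    exact (π.toHom_mul_apply q.1 q.2 v).symm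
  have hs : ContMDiff 𝓘(ℝ, E) 𝓘(ℝ, H) ∞
      fun g : G => vderiv E (fun h : G => π.toHom g (π.toHom h v)) 1 (y : E) := by
    intro g
    exact ((hf g).vderiv_partial (m := ∞) (by simp)).clm_apply contMDiffAt_const
  refine mem_smoothVectors.mpr (hs.congr fun g => ?_)
  have hd : MDifferentiableAt 𝓘(ℝ, E) 𝓘(ℝ, H) (fun h : G => π.toHom g (π.toHom h v)) 1 := by
    have h := (hf g).comp (1 : G) (contMDiffAt_const.prodMk contMDiffAt_id :
      ContMDiffAt 𝓘(ℝ, E) (𝓘(ℝ, E).prod 𝓘(ℝ, E)) ∞ (fun h : G => (g, h)) 1)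
    exact h.mdifferentiableAt (by simp)
  have h1 := hasDerivAt_comp_lieExp hd y
  have h2 := (((π.toHom g).toContinuousLinearEquiv : H →L[ℂ] H).restrictScalars
    ℝ).hasFDerivAt.comp_hasDerivAt 0 (π.hasDerivAt_toHom_lieExp hv y)
  exact h2.unique h1

end UnitaryRepresentation

/-! ### Closable operators and their closures -/

namespace LinearPMap
variable {H : Type*} [NormedAddCommGroup H] [InnerProductSpace ℂ H]

lemma IsClosable.exists_seq {T : H →ₗ.[ℂ] H} (hT : T.IsClosable) {v z : H}
    (h : (v, z) ∈ T.closure.graph) : ∃ u : ℕ → T.domain,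
      Tendsto (fun n => (u n : H)) atTop (𝓝 v) ∧ Tendsto (fun n => T (u n)) atTop (𝓝 z) := by
  rw [← hT.graph_closure_eq_closure_graph] at h
  obtain ⟨q, hq, hlim⟩ := mem_closure_iff_seq_limit.mp
    (show (v, z) ∈ _root_.closure (T.graph : Set (H × H)) from h)
  choose u hu using fun n => (T.mem_graph_iff).mp (hq n)
  refine ⟨u, ?_, ?_⟩
  · simpa only [(hu _).1, Function.comp_def] using (continuous_fst.tendsto _).comp hlim
  · simpa only [(hu _).2, Function.comp_def] using (continuous_snd.tendsto _).comp hlim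

lemma IsClosable.mem_graph_of_tendsto {T : H →ₗ.[ℂ] H} (hT : T.IsClosable) {v z : H}
    {u : ℕ → T.domain} (hv : Tendsto (fun n => (u n : H)) atTop (𝓝 v))
    (hz : Tendsto (fun n => T (u n)) atTop (𝓝 z)) : (v, z) ∈ T.closure.graph := by
  rw [← hT.graph_closure_eq_closure_graph]
  exact mem_closure_iff_seq_limit.mpr
    ⟨fun n => ((u n : H), T (u n)), fun n => T.mem_graph (u n), hv.prodMk_nhds hz⟩

/-- An operator with a formal adjoint on a dense subspace is closable. -/
lemma isClosable_of_dense_formalAdjoint {T : H →ₗ.[ℂ] H} {D : Set H} (hD : Dense D)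
    (h : ∀ w ∈ D, ∃ w' : H, ∀ v : T.domain, ⟪w, T v⟫_ℂ = ⟪w', (v : H)⟫_ℂ) : T.IsClosable := by
  refine ⟨T.graph.topologicalClosure.toLinearPMap, (Submodule.toLinearPMap_graph_eq _ ?_).symm⟩
  rintro ⟨v, z⟩ hvz (rfl : v = 0)
  obtain ⟨q, hq, hlim⟩ := mem_closure_iff_seq_limit.mp
    (show ((0 : H), z) ∈ _root_.closure (T.graph : Set (H × H)) from hvz)
  refine hD.eq_zero_of_inner_right (𝕜 := ℂ) fun w hw => ?_
  obtain ⟨w', hw'⟩ := h w hw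
  have h1 : Tendsto (fun n => ⟪w, (q n).2⟫_ℂ) atTop (𝓝 ⟪w, z⟫_ℂ) :=
    (tendsto_const_nhds).inner ((continuous_snd.tendsto _).comp hlim)
  have h2 : Tendsto (fun n => ⟪w', (q n).1⟫_ℂ) atTop (𝓝 ⟪w', (0 : H)⟫_ℂ) :=
    (tendsto_const_nhds).inner ((continuous_fst.tendsto _).comp hlim)
  have e : (fun n => ⟪w, (q n).2⟫_ℂ) = fun n => ⟪w', (q n).1⟫_ℂ := by
    ext n
    obtain ⟨v, hv1, hv2⟩ := (T.mem_graph_iff).mp (hq n)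
    rw [← hv1, ← hv2, hw']
  rw [e] at h1
  simpa using tendsto_nhds_unique h1 h2

end LinearPMap

/-! ### Closures of the operators of a pre-representation and their action on smooth vectors -/

namespace PreRepresentation
variable {E G 𝔤 : Type*}
  [NormedAddCommGroup E] [NormedSpace ℝ E] [CompleteSpace E]
  [TopologicalSpace G] [T2Space G] [ChartedSpace E G] [Group G] [LieGroup 𝓘(ℝ, E) ω G]
  [NormedAddCommGroup 𝔤] [NormedSpace ℝ 𝔤] [CompleteSpace 𝔤]
  {S : BanachLieSupergroup E G 𝔤}
  {H : Type*} [NormedAddCommGroup H] [InnerProductSpace ℂ H] [CompleteSpace H]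
  (P : PreRepresentation S H)

lemma exists_seq_of_mem_closure_graph {x : 𝔤} (hc : (P.op x).IsClosable) {v z : H}
    (h : (v, z) ∈ (P.op x).closure.graph) : ∃ u : ℕ → P.B,
      Tendsto (fun n => (u n : H)) atTop (𝓝 v) ∧ Tendsto (fun n => (P.ρ x (u n) : H)) atTop (𝓝 z) :=
  hc.exists_seq h

lemma mem_closure_graph_of_tendsto {x : 𝔤} (hc : (P.op x).IsClosable) {v z : H} {u : ℕ → P.B}
    (hv : Tendsto (fun n => (u n : H)) atTop (𝓝 v))
    (hz : Tendsto (fun n => (P.ρ x (u n) : H)) atTop (𝓝 z)) : (v, z) ∈ (P.op x).closure.graph :=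
  hc.mem_graph_of_tendsto hv hz

lemma isClosable_op_even {x : 𝔤} (hx : x ∈ S.alg.part 0) : (P.op x).IsClosable :=
  (P.ρ_even_essentiallySkewAdjoint x hx).2.1

lemma eq_of_inner_B {z z' : H} (h : ∀ w : P.B, ⟪(w : H), z⟫_ℂ = ⟪(w : H), z'⟫_ℂ) : z = z' :=
  P.dense_B.eq_of_inner_right (𝕜 := ℂ) fun w hw => h ⟨w, hw⟩

/-! ### The even operators -/

/-- The closure of `ρ(y)`, for `y` even, extends the generator. -/
theorem generator_mem_closure_graph (y : GroupLieAlgebra 𝓘(ℝ, E) G) (v : (P.π.generator y).domain) :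
    ((v : H), P.π.generator y v) ∈ (P.op (S.lieEquiv y)).closure.graph := by
  have hc := P.isClosable_op_even (S.lieEquiv y).2
  have hadj := (P.ρ_even_essentiallySkewAdjoint _ (S.lieEquiv y).2).2.2
  change (P.op (S.lieEquiv y)).closure.adjoint = -(P.op (S.lieEquiv y)).closure at hadj
  have hdc : Dense ((P.op (S.lieEquiv y)).closure.domain : Set H) :=
    P.dense_B.mono (P.op (S.lieEquiv y)).le_closure.1
  -- Skew-symmetry of the generator, passed to the limit from `B`, puts `v` in the domain of the
  -- adjoint with value -dπ(y)v. The adjoint being minus the closure, the claim follows.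
  have key : ∀ u : (P.op (S.lieEquiv y)).closure.domain,
      ⟪-P.π.generator y v, (u : H)⟫_ℂ = ⟪(v : H), (P.op (S.lieEquiv y)).closure u⟫_ℂ := by
    intro u
    obtain ⟨w, hw, hw'⟩ := P.exists_seq_of_mem_closure_graph hc ((P.op (S.lieEquiv y)).closure.mem_graph u)
    refine tendsto_nhds_unique (tendsto_const_nhds.inner hw)
      ((tendsto_const_nhds.inner hw').congr fun n => ?_)
    have h := P.π.inner_generator y v ⟨_, P.B_le_domain y (w n).2⟩
    rw [inner_neg_left, h, neg_neg, P.ρ_even]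
  have hv : (v : H) ∈ (P.op (S.lieEquiv y)).closure.adjoint.domain :=
    LinearPMap.mem_adjoint_domain_of_exists _ ⟨_, key⟩
  have hval := LinearPMap.adjoint_apply_eq hdc ⟨v, hv⟩ key
  have hg : ((v : H), -P.π.generator y v) ∈ (-(P.op (S.lieEquiv y)).closure).graph := by
    rw [← hadj, ← hval]
    exact LinearPMap.mem_graph _ ⟨(v : H), hv⟩
  obtain ⟨u, hu1, hu2⟩ := LinearPMap.mem_graph_iff _ |>.mp hg
  rw [LinearPMap.neg_apply, neg_inj] at hu2
  exact LinearPMap.mem_graph_iff _ |>.mpr ⟨u, hu1, hu2⟩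

/-! ### The odd operators -/

lemma inner_ρ_odd {x : 𝔤} (hx : x ∈ S.alg.part 1) (w v : P.B) :
    ⟪(P.ρ x w : H), (v : H)⟫_ℂ = -Complex.I * ⟪(w : H), (P.ρ x v : H)⟫_ℂ := by
  have h := P.ρ_odd_symmetric x hx w v
  simp only [LinearMap.smul_apply, Submodule.coe_inner, inner_smul_left,
    inner_smul_right] at h
  set c := Complex.exp (-(Real.pi * Complex.I / 4)) with hc
  have hc0 : (starRingEnd ℂ) c ≠ 0 := by simp [hc]
  -- The quotient of c by its conjugate is e^{-πi/2}; this produces the factor -i.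
  have e : c = -Complex.I * (starRingEnd ℂ) c := by
    have hI : -Complex.I = Complex.exp (-(Real.pi / 2 * Complex.I)) := by
      rw [Complex.exp_neg, Complex.exp_pi_div_two_mul_I, Complex.inv_I]
    rw [hI, hc, ← Complex.exp_conj, ← Complex.exp_add]
    congr 1
    have h4 : (starRingEnd ℂ) 4 = 4 := Complex.conj_ofNat 4
    simp only [map_neg, map_div₀, map_mul, Complex.conj_ofReal, Complex.conj_I, h4]
    ring
  refine mul_left_cancel₀ hc0 (h.trans ?_)
  nth_rw 1 [e]
  ring

omit [T2Space G] in
lemma bracket_self_mem {x : 𝔤} (hx : x ∈ S.alg.part 1) : S.alg.bracket x x ∈ S.alg.part 0 :=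
  S.alg.bracket_mem 1 1 x x hx hx

lemma two_smul_ρ_sq {x : 𝔤} (hx : x ∈ S.alg.part 1) (v : P.B) :
    P.ρ (S.alg.bracket x x) v = (2 : ℂ) • P.ρ x (P.ρ x v) := by
  rw [P.ρ_bracket 1 1 x x hx hx]
  have : superSign 1 1 = -1 := by
    rw [superSign, show (1 : ZMod 2).val = 1 from rfl]
    norm_num
  rw [this]
  simp [two_smul]

/-- ‖ρ(x)v‖² = -i⟨v, ρ(x)²v⟩, where ρ(x)² = ½ρ([x,x]); then Cauchy–Schwarz. The factor ½ is
discarded. -/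
lemma norm_ρ_odd_sq_le {x : 𝔤} (hx : x ∈ S.alg.part 1) (v : P.B) :
    ‖(P.ρ x v : H)‖ ^ 2 ≤ ‖(v : H)‖ * ‖(P.ρ (S.alg.bracket x x) v : H)‖ := by
  have h : ((‖(P.ρ x v : H)‖ ^ 2 : ℝ) : ℂ) = -Complex.I * ⟪(v : H), (P.ρ x (P.ρ x v) : H)⟫_ℂ := by
    rw [← P.inner_ρ_odd hx, inner_self_eq_norm_sq_to_K]
    norm_cast
  have h2 := congrArg norm h
  rw [Complex.norm_real, norm_mul, norm_neg, Complex.norm_I, one_mul, norm_pow, norm_norm] at h2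
  rw [h2]
  refine (norm_inner_le_norm _ _).trans ?_
  gcongr
  rw [P.two_smul_ρ_sq hx, Submodule.coe_smul, norm_smul]
  norm_num
  linarith [norm_nonneg (P.ρ x (P.ρ x v) : H)]

lemma isClosable_op_odd {x : 𝔤} (hx : x ∈ S.alg.part 1) : (P.op x).IsClosable := by
  refine LinearPMap.isClosable_of_dense_formalAdjoint P.dense_B fun w hw =>
    ⟨-Complex.I • (P.ρ x ⟨w, hw⟩ : H), fun v => ?_⟩
  refine Eq.trans ?_ (inner_smul_left _ _ _).symm
  refine Eq.trans ?_ (congrArg _ (P.inner_ρ_odd hx ⟨w, hw⟩ v).symm)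
  rw [← mul_assoc]
  simp
  rfl

lemma inner_closure_odd {x : 𝔤} (hx : x ∈ S.alg.part 1) {v z : H}
    (h : (v, z) ∈ (P.op x).closure.graph) (w : P.B) :
    ⟪(P.ρ x w : H), v⟫_ℂ = -Complex.I * ⟪(w : H), z⟫_ℂ := by
  obtain ⟨u, hu, hu'⟩ := P.exists_seq_of_mem_closure_graph (P.isClosable_op_odd hx) h
  exact tendsto_nhds_unique (tendsto_const_nhds.inner hu)
    (((tendsto_const_nhds.inner hu').const_mul _).congr fun n => (P.inner_ρ_odd hx w (u n)).symm)

/-- The domain of the closure of `ρ([x,x])` lies in the domain of the closure of `ρ(x)`. -/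
theorem exists_mem_closure_graph_odd {x : 𝔤} (hx : x ∈ S.alg.part 1) {v z : H}
    (h : (v, z) ∈ (P.op (S.alg.bracket x x)).closure.graph) :
    ∃ z', (v, z') ∈ (P.op x).closure.graph ∧ ‖z'‖ ^ 2 ≤ ‖v‖ * ‖z‖ := by
  obtain ⟨u, hu, hu'⟩ :=
    P.exists_seq_of_mem_closure_graph (P.isClosable_op_even (bracket_self_mem hx)) h
  -- The quadratic estimate, applied to differences, transfers convergence in the graph norm of
  -- ρ([x,x]) to that of ρ(x).
  have hcauchy : CauchySeq fun n => (P.ρ x (u n) : H) := by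
    rw [cauchySeq_iff_tendsto_dist_atTop_0]
    have h1 := cauchySeq_iff_tendsto_dist_atTop_0.mp hu.cauchySeq
    have h2 := cauchySeq_iff_tendsto_dist_atTop_0.mp hu'.cauchySeq
    have h3 : Tendsto (fun n : ℕ × ℕ => dist (P.ρ x (u n.1) : H) (P.ρ x (u n.2)) ^ 2) atTop (𝓝 0) := by
      refine squeeze_zero (fun _ => by positivity) (fun n => ?_) (by simpa using h1.mul h2)
      have h4 := P.norm_ρ_odd_sq_le hx (u n.1 - u n.2)
      simpa only [map_sub, Submodule.coe_sub, ← dist_eq_norm] using h4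
    simpa [Real.sqrt_sq dist_nonneg] using h3.sqrt
  obtain ⟨z', hz'⟩ := cauchySeq_tendsto_of_complete hcauchy
  refine ⟨z', P.mem_closure_graph_of_tendsto (P.isClosable_op_odd hx) hu hz', ?_⟩
  exact le_of_tendsto_of_tendsto' (hz'.norm.pow 2) (hu.norm.mul hu'.norm)
    fun n => P.norm_ρ_odd_sq_le hx (u n)

/-- The even element `[x, x]`, for `x` odd, in the Lie algebra of `G`. -/
def square (S : BanachLieSupergroup E G 𝔤) (x : S.alg.part 1) : GroupLieAlgebra 𝓘(ℝ, E) G :=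
  S.lieEquiv.symm ⟨S.alg.bracket x x, bracket_self_mem x.2⟩

lemma exists_closure_odd (x : S.alg.part 1) (v : P.π.smoothVectors E) :
    ∃ z', ((v : H), z') ∈ (P.op (x : 𝔤)).closure.graph ∧
      ‖z'‖ ^ 2 ≤ ‖(v : H)‖ * ‖P.π.orbitDeriv E (v : H) (square S x)‖ := by
  have h := P.generator_mem_closure_graph (square S x) ⟨v, P.π.mem_generator_domain v.2 _⟩
  rw [P.π.generator_apply v.2, square, S.lieEquiv.apply_symm_apply] at h
  exact P.exists_mem_closure_graph_odd x.2 h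

lemma mem_closure_odd_domain (x : S.alg.part 1) (v : P.π.smoothVectors E) :
    (v : H) ∈ (P.op (x : 𝔤)).closure.domain := by
  obtain ⟨z', h, -⟩ := P.exists_closure_odd x v
  exact LinearPMap.mem_domain_of_mem_graph h

lemma inner_closure_odd_apply (x : S.alg.part 1) (v : P.π.smoothVectors E) (w : P.B) :
    ⟪(P.ρ x w : H), (v : H)⟫_ℂ
      = -Complex.I * ⟪(w : H), (P.op (x : 𝔤)).closure ⟨v, P.mem_closure_odd_domain x v⟩⟫_ℂ :=
  P.inner_closure_odd x.2 (LinearPMap.mem_graph _ ⟨(v : H), P.mem_closure_odd_domain x v⟩) w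

lemma eq_of_inner_ρ {z z' : H} (h : ∀ w : P.B, -Complex.I * ⟪(w : H), z⟫_ℂ = -Complex.I * ⟪(w : H), z'⟫_ℂ) :
    z = z' :=
  P.eq_of_inner_B fun w => mul_left_cancel₀ (neg_ne_zero.mpr Complex.I_ne_zero) (h w)

/-- The action of the odd part of `𝔤` on the smooth vectors by the closures of the `ρ(x)`. -/
def oddAction : S.alg.part 1 →ₗ[ℝ] P.π.smoothVectors E →ₗ[ℂ] H where
  toFun x :=
    { toFun := fun v => (P.op (x : 𝔤)).closure ⟨v, P.mem_closure_odd_domain x v⟩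
      map_add' := fun v w => ((P.op (x : 𝔤)).closure.map_add ⟨v, P.mem_closure_odd_domain x v⟩
        ⟨w, P.mem_closure_odd_domain x w⟩)
      map_smul' := fun c v =>
        ((P.op (x : 𝔤)).closure.map_smul c ⟨v, P.mem_closure_odd_domain x v⟩) }
  map_add' x y := by
    ext v
    -- Additivity in x is not formal for closures. Paired with `w` in `B`, the operators move onto
    -- `w`, where ρ is linear in x.
    refine P.eq_of_inner_ρ fun w => ?_
    change -Complex.I * ⟪(w : H), (P.op ((x + y : S.alg.part 1) : 𝔤)).closure
      ⟨v, P.mem_closure_odd_domain (x + y) v⟩⟫_ℂ = -Complex.I * ⟪(w : H),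
      (P.op (x : 𝔤)).closure ⟨v, P.mem_closure_odd_domain x v⟩
        + (P.op (y : 𝔤)).closure ⟨v, P.mem_closure_odd_domain y v⟩⟫_ℂ
    rw [inner_add_right, mul_add, ← P.inner_closure_odd_apply, ← P.inner_closure_odd_apply,
      ← P.inner_closure_odd_apply]
    rw [Submodule.coe_add, map_add, LinearMap.add_apply, Submodule.coe_add, inner_add_left]
  map_smul' r x := by
    ext v
    refine P.eq_of_inner_ρ fun w => ?_
    change -Complex.I * ⟪(w : H), (P.op ((r • x : S.alg.part 1) : 𝔤)).closure
      ⟨v, P.mem_closure_odd_domain (r • x) v⟩⟫_ℂ = -Complex.I * ⟪(w : H),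
      r • (P.op (x : 𝔤)).closure ⟨v, P.mem_closure_odd_domain x v⟩⟫_ℂ
    rw [← Complex.coe_smul r, inner_smul_right, mul_left_comm, ← P.inner_closure_odd_apply,
      ← P.inner_closure_odd_apply]
    have e : (P.ρ (r • x : S.alg.part 1) w : H) = (r : ℂ) • (P.ρ x w : H) := by
      rw [Submodule.coe_smul, map_smul]
      exact (Complex.coe_smul r _).symm
    rw [e, inner_smul_left, Complex.conj_ofReal]

lemma inner_oddAction (x : S.alg.part 1) (v : P.π.smoothVectors E) (w : P.B) :
    ⟪(P.ρ x w : H), (v : H)⟫_ℂ = -Complex.I * ⟪(w : H), P.oddAction x v⟫_ℂ :=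
  P.inner_closure_odd_apply x v w

lemma norm_oddAction_sq_le (x : S.alg.part 1) (v : P.π.smoothVectors E) :
    ‖P.oddAction x v‖ ^ 2 ≤ ‖(v : H)‖ * ‖P.π.orbitDeriv E (v : H) (square S x)‖ := by
  obtain ⟨z', h, hz'⟩ := P.exists_closure_odd x v
  have e : P.oddAction x v = z' := LinearPMap.mem_graph_snd_inj _
    (LinearPMap.mem_graph _ ⟨(v : H), P.mem_closure_odd_domain x v⟩) h rfl
  rwa [e]

variable (E) in
/-- The derived action of the Lie algebra of `G` on smooth vectors. -/
def evenAction (y : GroupLieAlgebra 𝓘(ℝ, E) G) (v : P.π.smoothVectors E) : P.π.smoothVectors E :=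
  ⟨P.π.orbitDeriv E (v : H) y, P.π.orbitDeriv_mem_smoothVectors v.2 y⟩

/-- The bracket of an even and an odd element. -/
def evenOddBracket (S : BanachLieSupergroup E G 𝔤) (y : GroupLieAlgebra 𝓘(ℝ, E) G) (x : S.alg.part 1) :
    S.alg.part 1 :=
  ⟨S.alg.bracket (S.lieEquiv y) x, by
    simpa using S.alg.bracket_mem 0 1 _ _ (S.lieEquiv y).2 x.2⟩

/-- The odd operators are moved onto `w`, where ρ([y,x]) is the commutator of ρ(y) and ρ(x). The
weak form avoids asking that T(x)v lie in the domain of the generator. -/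
lemma inner_generator_oddAction_of_mem_B (y : GroupLieAlgebra 𝓘(ℝ, E) G) (x : S.alg.part 1)
    (v : P.π.smoothVectors E) (w : P.B) :
    ⟪(P.ρ (S.lieEquiv y) w : H), P.oddAction x v⟫_ℂ
      = -⟪(w : H), P.oddAction x (P.evenAction E y v) + P.oddAction (evenOddBracket S y x) v⟫_ℂ := by
  have h1 := P.inner_oddAction x v (P.ρ (S.lieEquiv y) w)
  have h2 := P.inner_oddAction (evenOddBracket S y x) v w
  have h3 := P.inner_oddAction x (P.evenAction E y v) w
  have h4 := P.π.inner_generator y ⟨_, P.B_le_domain y (P.ρ x w).2⟩ ⟨v, P.π.mem_generator_domain v.2 y⟩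
  rw [← P.ρ_even, P.π.generator_apply v.2] at h4
  have h5 : P.ρ (evenOddBracket S y x : S.alg.part 1)
      = P.ρ (S.lieEquiv y) * P.ρ x - P.ρ x * P.ρ (S.lieEquiv y) := by
    have := P.ρ_bracket 0 1 _ _ (S.lieEquiv y).2 x.2
    simpa [superSign, evenOddBracket] using this
  rw [h5, LinearMap.sub_apply, Submodule.coe_sub, inner_sub_left] at h2
  simp only [Module.End.mul_apply] at h2
  rw [h1, h4] at h2
  change ⟪_, (P.evenAction E y v : H)⟫_ℂ = _ at h3
  change -⟪_, (P.evenAction E y v : H)⟫_ℂ - _ = _ at h2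
  rw [h3] at h2
  rw [inner_add_right]
  refine mul_left_cancel₀ Complex.I_ne_zero ?_
  linear_combination h2

/-- The commutation relation of the even and the odd operators, tested against the domain of the
even one. -/
theorem inner_generator_oddAction (y : GroupLieAlgebra 𝓘(ℝ, E) G) (x : S.alg.part 1)
    (v : P.π.smoothVectors E) (w : (P.π.generator y).domain) :
    ⟪P.π.generator y w, P.oddAction x v⟫_ℂ
      = -⟪(w : H), P.oddAction x (P.evenAction E y v) + P.oddAction (evenOddBracket S y x) v⟫_ℂ := by
  obtain ⟨u, hu, hu'⟩ := P.exists_seq_of_mem_closure_graph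
    (P.isClosable_op_even (S.lieEquiv y).2) (P.generator_mem_closure_graph y w)
  exact tendsto_nhds_unique (hu'.inner tendsto_const_nhds)
    ((hu.inner tendsto_const_nhds).neg.congr fun n =>
      (P.inner_generator_oddAction_of_mem_B y x v (u n)).symm)

end PreRepresentation

/-! ### Orbits of smooth vectors and of generator domains under one-parameter groups -/

namespace UnitaryRepresentation
variable {E : Type*} [NormedAddCommGroup E] [NormedSpace ℝ E] [CompleteSpace E]
  {G : Type*} [TopologicalSpace G] [T2Space G] [ChartedSpace E G] [Group G] [LieGroup 𝓘(ℝ, E) ω G]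
  {H : Type*} [NormedAddCommGroup H] [InnerProductSpace ℂ H] (π : UnitaryRepresentation G H)

lemma orbitDeriv_sub {v w : H} (hv : v ∈ π.smoothVectors E) (hw : w ∈ π.smoothVectors E) :
    π.orbitDeriv E (v - w) = π.orbitDeriv E v - π.orbitDeriv E w := by
  refine ContinuousLinearMap.ext fun y => ?_
  have h := π.hasDerivAt_toHom_lieExp (sub_mem hv hw) y
  simp only [map_sub] at h
  exact h.unique ((π.hasDerivAt_toHom_lieExp hv y).sub (π.hasDerivAt_toHom_lieExp hw y))

lemma orbitDeriv_smul (r : ℝ) {v : H} (hv : v ∈ π.smoothVectors E) :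
    π.orbitDeriv E (r • v) = r • π.orbitDeriv E v := by
  refine ContinuousLinearMap.ext fun y => ?_
  have h := π.hasDerivAt_toHom_lieExp ((π.smoothVectors E).smul_mem (r : ℂ) hv) y
  simp only [map_smul] at h
  have h2 := h.unique ((π.hasDerivAt_toHom_lieExp hv y).const_smul (r : ℂ))
  rw [Complex.coe_smul] at h2
  rw [h2]
  exact Complex.coe_smul _ _

/-- The derivative is taken in operator norm, as the quadratic estimate involves the norm of the
whole map dπ(·)v. -/
lemma hasDerivAt_orbitDeriv {v : H} (hv : v ∈ π.smoothVectors E) (y : GroupLieAlgebra 𝓘(ℝ, E) G) :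
    ∃ L : E →L[ℝ] H,
      HasDerivAt (fun t : ℝ => π.orbitDeriv E (π.toHom (lieExp (t • y)) v)) L 0 :=
  ⟨_, hasDerivAt_comp_lieExp ((π.contMDiff_orbitDeriv hv).mdifferentiableAt (by simp)) y⟩

/-- `B` is not assumed invariant under π, so a vector of `B` is followed along the group inside the
larger domain of the generator, which is invariant because the one-parameter group is commutative.
-/
lemma toHom_lieExp_mem_generator_domain {y : GroupLieAlgebra 𝓘(ℝ, E) G} {w : H}
    (hw : w ∈ (π.generator y).domain) (t : ℝ) :
    π.toHom (lieExp (t • y)) w ∈ (π.generator y).domain := by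
  have h : DifferentiableAt ℝ (fun s : ℝ => π.toHom (lieExp (t • y)) (π.toHom (lieExp (s • y)) w)) 0 :=
    ((((π.toHom (lieExp (t • y))).toContinuousLinearEquiv : H →L[ℂ] H).restrictScalars
      ℝ).differentiableAt).comp 0 (show DifferentiableAt ℝ _ 0 from hw)
  refine h.congr_of_eventuallyEq (Eventually.of_forall fun s => ?_)
  change π.toHom _ (π.toHom _ w) = π.toHom _ (π.toHom _ w)
  rw [← toHom_mul_apply, ← toHom_mul_apply, ← lieExp_add_smul, ← lieExp_add_smul, add_comm]

lemma hasDerivAt_toHom_lieExp_of_mem_domain {y : GroupLieAlgebra 𝓘(ℝ, E) G} {w : H}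
    (hw : w ∈ (π.generator y).domain) (t : ℝ) :
    HasDerivAt (fun s : ℝ => π.toHom (lieExp (s • y)) w)
      (π.generator y ⟨_, π.toHom_lieExp_mem_generator_domain hw t⟩) t := by
  have h := π.hasDerivAt_generator y ⟨_, π.toHom_lieExp_mem_generator_domain hw t⟩
  have h2 := HasDerivAt.comp_sub_const t t (by rwa [sub_self])
  refine h2.congr_of_eventuallyEq (Eventually.of_forall fun s => ?_)
  change _ = π.toHom _ (π.toHom _ w)
  rw [← toHom_mul_apply, ← lieExp_add_smul, sub_add_cancel]

end UnitaryRepresentation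

/-! ### Equivariance of the odd action -/

namespace PreRepresentation
variable {E G 𝔤 : Type*}
  [NormedAddCommGroup E] [NormedSpace ℝ E] [CompleteSpace E]
  [TopologicalSpace G] [T2Space G] [ChartedSpace E G] [Group G] [LieGroup 𝓘(ℝ, E) ω G]
  [NormedAddCommGroup 𝔤] [NormedSpace ℝ 𝔤] [CompleteSpace 𝔤]
  {S : BanachLieSupergroup E G 𝔤}
  {H : Type*} [NormedAddCommGroup H] [InnerProductSpace ℂ H] [CompleteSpace H]
  (P : PreRepresentation S H)

/-- The restriction of `Ad g` to the odd part. -/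
def adOdd (S : BanachLieSupergroup E G 𝔤) (g : G) (x : S.alg.part 1) : S.alg.part 1 :=
  ⟨S.Ad g x, S.Ad_mem g 1 x x.2⟩

/-- The action of `g` on the smooth vectors. -/
def translate (g : G) (v : P.π.smoothVectors E) : P.π.smoothVectors E :=
  ⟨P.π.toHom g v, P.π.toHom_mem_smoothVectors v.2 g⟩

omit [T2Space G] in
lemma adOdd_mul (g h : G) (x : S.alg.part 1) : adOdd S (g * h) x = adOdd S g (adOdd S h x) := by
  ext
  simp only [adOdd, map_mul]
  rfl

lemma translate_mul (g h : G) (v : P.π.smoothVectors E) :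
    P.translate (g * h) v = P.translate g (P.translate h v) :=
  Subtype.ext (P.π.toHom_mul_apply g h v)

omit [T2Space G] in
lemma adOdd_one (x : S.alg.part 1) : adOdd S 1 x = x := by
  ext
  simp only [adOdd, map_one]
  rfl

lemma translate_one (v : P.π.smoothVectors E) : P.translate 1 v = v :=
  Subtype.ext (P.π.toHom_one_apply v)

/-- Joint control in x and v, obtained from ‖[x,x]‖ ≤ ‖x‖² and the continuity of the identification
of the even part with the Lie algebra of `G`. -/
lemma exists_norm_oddAction_sq_le : ∃ C : ℝ, 0 ≤ C ∧ ∀ (x : S.alg.part 1) (v : P.π.smoothVectors E),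
    ‖P.oddAction x v‖ ^ 2 ≤ C * (‖x‖ ^ 2 * (‖(v : H)‖ * ‖P.π.orbitDeriv E (v : H)‖)) := by
  let L : S.alg.part 0 →L[ℝ] E := (S.lieEquiv.symm : S.alg.part 0 →L[ℝ] GroupLieAlgebra 𝓘(ℝ, E) G)
  refine ⟨‖L‖, L.opNorm_nonneg, fun x v => (P.norm_oddAction_sq_le x v).trans ?_⟩
  have h1 : ‖P.π.orbitDeriv E (v : H) (square S x)‖ ≤ ‖P.π.orbitDeriv E (v : H)‖ * (‖L‖ * ‖x‖ ^ 2) := by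
    refine (P.π.orbitDeriv E (v : H)).le_opNorm_of_le ?_
    refine L.le_opNorm_of_le (x := ⟨S.alg.bracket x x, bracket_self_mem x.2⟩) ?_
    rw [pow_two]
    exact S.alg.norm_bracket_le x x
  calc ‖(v : H)‖ * ‖P.π.orbitDeriv E (v : H) (square S x)‖
      ≤ ‖(v : H)‖ * (‖P.π.orbitDeriv E (v : H)‖ * (‖L‖ * ‖x‖ ^ 2)) := by gcongr
    _ = _ := by ring

lemma hasDerivAt_Ad (z : GroupLieAlgebra 𝓘(ℝ, E) G) (x : 𝔤) :
    HasDerivAt (fun h : ℝ => S.Ad (lieExp (h • z)) x) (S.alg.bracket (S.lieEquiv z) x) 0 := by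
  have h := hasDerivAt_comp_lieExp (S.Ad_analytic.mdifferentiableAt (by simp)) z
  have h2 := h.clm_apply (hasDerivAt_const (0 : ℝ) x)
  simp only [map_zero, add_zero] at h2
  have e : vderiv E (fun g : G => (S.Ad g : 𝔤 →L[ℝ] 𝔤)) 1 z x = S.alg.bracket (S.lieEquiv z) x :=
    S.mfderiv_Ad z x
  rw [e] at h2
  exact h2

open Asymptotics in
lemma isLittleO_of_norm_sq_le {F : Type*} [NormedAddCommGroup F] {f : ℝ → F} {k g : ℝ → ℝ} {C : ℝ}
    {l : Filter ℝ} (hf : ∀ h, ‖f h‖ ^ 2 ≤ C * k h) (hk : k =o[l] fun h => g h ^ 2) : f =o[l] g := by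
  refine IsLittleO.of_norm_left (IsLittleO.of_pow (n := 2) ?_ two_ne_zero)
  refine IsBigO.trans_isLittleO (IsBigO.of_bound |C| (Eventually.of_forall fun h => ?_)) hk
  change ‖‖f h‖ ^ 2‖ ≤ |C| * ‖k h‖
  rw [← Real.norm_eq_abs, ← norm_mul, Real.norm_of_nonneg (by positivity)]
  exact (hf h).trans (le_abs_self _)

-- With a = dπ(z)v, b = [z,x], X = Ad(g_h)x and W = π(g_h)v, the error of the linear approximation
-- is T(X - x - hb)W + h T(b)(W - v) + T(x)(W - v - ha). The quadratic estimate makes each term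
-- o(h).
open Asymptotics in
theorem hasDerivAt_oddAction_zero (z : GroupLieAlgebra 𝓘(ℝ, E) G) (x : S.alg.part 1)
    (v : P.π.smoothVectors E) :
    HasDerivAt (fun h : ℝ => P.oddAction (adOdd S (lieExp (h • z)) x) (P.translate (lieExp (h • z)) v))
      (P.oddAction x (P.evenAction E z v) + P.oddAction (evenOddBracket S z x) v) 0 := by
  obtain ⟨C, hC, hT⟩ := P.exists_norm_oddAction_sq_le
  set b := evenOddBracket S z x
  set a := P.evenAction E z v
  set X : ℝ → S.alg.part 1 := fun h => adOdd S (lieExp (h • z)) x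
  set W : ℝ → P.π.smoothVectors E := fun h => P.translate (lieExp (h • z)) v
  have hX0 : X 0 = x := by simp only [X, zero_smul, lieExp_zero, adOdd_one]
  have hW0 : W 0 = v := by simp only [W, zero_smul, lieExp_zero, translate_one]
  have hW : HasDerivAt (fun h => (W h : H)) (a : H) 0 := P.π.hasDerivAt_toHom_lieExp v.2 z
  have hWo : (fun h : ℝ => ((W h - v - (h : ℂ) • a : P.π.smoothVectors E) : H)) =o[𝓝 0] fun h => h := by
    have h := hasDerivAt_iff_isLittleO.mp hW
    simp only [hW0, sub_zero] at h
    exact h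
  have hXo : (fun h : ℝ => X h - x - h • b) =o[𝓝 0] fun h => h := by
    have h := hasDerivAt_iff_isLittleO.mp (hasDerivAt_Ad (S := S) z (x : 𝔤))
    simp only [zero_smul, lieExp_zero, map_one, sub_zero] at h
    exact IsLittleO.of_norm_left (h.norm_left.congr_left fun _ => rfl)
  obtain ⟨L, hL⟩ := P.π.hasDerivAt_orbitDeriv v.2 z
  have hD0 : P.π.orbitDeriv E (P.π.toHom (lieExp ((0 : ℝ) • z)) (v : H)) = P.π.orbitDeriv E (v : H) := by
    rw [zero_smul, lieExp_zero, P.π.toHom_one_apply]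
  have hDO : (fun h : ℝ => P.π.orbitDeriv E (W h : H) - P.π.orbitDeriv E (v : H)) =O[𝓝 0] fun h => h := by
    have h := hL.isBigO_sub
    simp only [hD0, sub_zero] at h
    exact h
  have hWO : (fun h => ‖(W h : H)‖) =O[𝓝 0] fun _ : ℝ => (1 : ℝ) :=
    hW.continuousAt.norm.tendsto.isBigO_one ℝ
  have hDO1 : (fun h => ‖P.π.orbitDeriv E (W h : H)‖) =O[𝓝 0] fun _ : ℝ => (1 : ℝ) :=
    hL.continuousAt.norm.tendsto.isBigO_one ℝ
  have ho1 : (fun h : ℝ => h) =o[𝓝 0] fun _ : ℝ => (1 : ℝ) := (isLittleO_one_iff ℝ).mpr tendsto_id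
  have t1 : (fun h => P.oddAction (X h - x - h • b) (W h)) =o[𝓝 0] fun h : ℝ => h := by
    refine isLittleO_of_norm_sq_le (fun h => hT _ _) ?_
    simpa using (hXo.norm_left.pow two_pos).mul_isBigO (hWO.mul hDO1)
  have t2 : (fun h => P.oddAction b (W h - v)) =o[𝓝 0] fun _ : ℝ => (1 : ℝ) := by
    refine isLittleO_of_norm_sq_le (fun h => hT _ _) ?_
    have h1 : (fun h => ((W h - v : P.π.smoothVectors E) : H)) =o[𝓝 0] fun _ : ℝ => (1 : ℝ) := by
      have h := hW.isBigO_sub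
      simp only [hW0, sub_zero] at h
      exact h.trans_isLittleO ho1
    have h2 : (fun h => P.π.orbitDeriv E ((W h - v : P.π.smoothVectors E) : H)) =o[𝓝 0]
        fun _ : ℝ => (1 : ℝ) := by
      simp only [Submodule.coe_sub, P.π.orbitDeriv_sub (W _).2 v.2]
      exact hDO.trans_isLittleO ho1
    simpa using (isBigO_const_const (‖b‖ ^ 2) (one_ne_zero (α := ℝ)) (𝓝 (0 : ℝ))).mul_isLittleO
      (h1.norm_left.mul h2.norm_left)
  -- Here the square is bounded by o(h) · O(h): the vector is o(h), and for its orbit derivative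
  -- O(h) is enough.
  have t3 : (fun h : ℝ => P.oddAction x (W h - v - (h : ℂ) • a)) =o[𝓝 0] fun h : ℝ => h := by
    refine isLittleO_of_norm_sq_le (fun h => hT _ _) ?_
    have h2 : (fun h : ℝ => P.π.orbitDeriv E ((W h - v - (h : ℂ) • a : P.π.smoothVectors E) : H))
        =O[𝓝 0] fun h : ℝ => h := by
      have e : ∀ h : ℝ, P.π.orbitDeriv E ((W h - v - (h : ℂ) • a : P.π.smoothVectors E) : H)
          = P.π.orbitDeriv E (W h : H) - P.π.orbitDeriv E (v : H) - h • P.π.orbitDeriv E (a : H) := by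
        intro h
        rw [Submodule.coe_sub, P.π.orbitDeriv_sub (W h - v).2 ((h : ℂ) • a).2, Submodule.coe_sub,
          P.π.orbitDeriv_sub (W h).2 v.2, Submodule.coe_smul, Complex.coe_smul,
          P.π.orbitDeriv_smul h a.2]
      simp only [e]
      refine hDO.sub ?_
      simpa using (isBigO_refl (fun h : ℝ => h) (𝓝 0)).smul
        (isBigO_const_const (P.π.orbitDeriv E (a : H)) (one_ne_zero (α := ℝ)) (𝓝 (0 : ℝ)))
    simpa only [one_mul, ← pow_two] using
      (isBigO_const_const (‖x‖ ^ 2) (one_ne_zero (α := ℝ)) (𝓝 (0 : ℝ))).mul_isLittleO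
        (hWo.norm_left.mul_isBigO h2.norm_left)
  rw [hasDerivAt_iff_isLittleO]
  have t2' : (fun h => h • P.oddAction b (W h - v)) =o[𝓝 0] fun h : ℝ => h := by
    simpa using (isBigO_refl (fun h : ℝ => h) (𝓝 0)).smul_isLittleO t2
  refine ((t1.add t2').add t3).congr (fun h => ?_) (fun h => by simp)
  change _ = P.oddAction (X h) (W h) - P.oddAction (X 0) (W 0) - (h - 0) • _
  rw [hX0, hW0]
  simp only [map_sub, map_smul, LinearMap.sub_apply, LinearMap.smul_apply, sub_zero, smul_add, smul_sub]
  simp only [Complex.coe_smul]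
  abel

lemma hasDerivAt_oddAction (z : GroupLieAlgebra 𝓘(ℝ, E) G) (x : S.alg.part 1)
    (v : P.π.smoothVectors E) (t : ℝ) :
    HasDerivAt (fun s : ℝ => P.oddAction (adOdd S (lieExp (s • z)) x) (P.translate (lieExp (s • z)) v))
      (P.oddAction (adOdd S (lieExp (t • z)) x) (P.evenAction E z (P.translate (lieExp (t • z)) v))
        + P.oddAction (evenOddBracket S z (adOdd S (lieExp (t • z)) x))
          (P.translate (lieExp (t • z)) v)) t := by
  have h := P.hasDerivAt_oddAction_zero z (adOdd S (lieExp (t • z)) x) (P.translate (lieExp (t • z)) v)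
  have h2 := HasDerivAt.comp_sub_const t t (by rwa [sub_self])
  refine h2.congr_of_eventuallyEq (Eventually.of_forall fun s => ?_)
  dsimp only
  rw [← adOdd_mul, ← translate_mul, ← lieExp_add_smul, sub_add_cancel]

/-- Equivariance of the odd action along one-parameter subgroups. -/
theorem oddAction_lieExp (z : GroupLieAlgebra 𝓘(ℝ, E) G) (x : S.alg.part 1)
    (v : P.π.smoothVectors E) :
    P.oddAction (adOdd S (lieExp z) x) (P.translate (lieExp z) v)
      = P.π.toHom (lieExp z) (P.oddAction x v) := by
  -- Writing the left side as π(exp z)z' reduces the claim to ⟨w, z'⟩ = ⟨w, T(x)v⟩ for w in `B`,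
  -- which compares one function at times 1 and 0.
  obtain ⟨z', hz'⟩ := (P.π.toHom (lieExp z)).surjective
    (P.oddAction (adOdd S (lieExp z) x) (P.translate (lieExp z) v))
  rw [← hz']
  congr 1
  refine P.eq_of_inner_B fun w => ?_
  have hw := P.B_le_domain z w.2
  have hF : ∀ t : ℝ, HasDerivAt (fun s : ℝ => ⟪P.π.toHom (lieExp (s • z)) (w : H),
      P.oddAction (adOdd S (lieExp (s • z)) x) (P.translate (lieExp (s • z)) v)⟫_ℂ) 0 t := by
    intro t
    have h := (P.π.hasDerivAt_toHom_lieExp_of_mem_domain hw t).inner ℂ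
      (P.hasDerivAt_oddAction z x v t)
    -- The commutation relation makes the two terms of the product rule cancel.
    rwa [P.inner_generator_oddAction, add_neg_cancel] at h
  have h := is_const_of_deriv_eq_zero (fun t => (hF t).differentiableAt) (fun t => (hF t).deriv) 1 0
  simp only [one_smul, zero_smul, lieExp_zero, adOdd_one, translate_one, P.π.toHom_one_apply] at h
  rw [← h, ← hz']
  exact (LinearIsometryEquiv.inner_map_map _ _ _).symm

theorem oddAction_equivariant [ConnectedSpace G] (g : G) (x : S.alg.part 1) (v : P.π.smoothVectors E) :
    P.oddAction (adOdd S g x) (P.translate g v) = P.π.toHom g (P.oddAction x v) := by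
  have hg : g ∈ Subgroup.closure (range (lieExp : GroupLieAlgebra 𝓘(ℝ, E) G → G)) := by
    rw [closure_range_lieExp]
    trivial
  induction hg using Subgroup.closure_induction generalizing x v with
  | mem g hg =>
    obtain ⟨z, rfl⟩ := hg
    exact P.oddAction_lieExp z x v
  | one => rw [adOdd_one, translate_one, P.π.toHom_one_apply]
  | mul g h _ _ ihg ihh =>
    rw [adOdd_mul, translate_mul, ihg, ihh, P.π.toHom_mul_apply]
  | inv g _ ih =>
    have h := ih (adOdd S g⁻¹ x) (P.translate g⁻¹ v)
    rw [← adOdd_mul, ← translate_mul, mul_inv_cancel, adOdd_one, translate_one] at h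
    rw [h, ← P.π.toHom_mul_apply, inv_mul_cancel, P.π.toHom_one_apply]

end PreRepresentation

/-! ### Real and imaginary parts, and passage to the complexification -/

section Complexification
variable {V : Type*} [AddCommGroup V] [Module ℝ V]

lemma reC_tmul (c : ℂ) (m : V) : reC (c ⊗ₜ[ℝ] m) = c.re • m := by simp [reC]

lemma imC_tmul (c : ℂ) (m : V) : imC (c ⊗ₜ[ℝ] m) = c.im • m := by simp [imC]

lemma reC_baseChange (f : V →ₗ[ℝ] V) (x : ℂ ⊗[ℝ] V) : reC (f.baseChange ℂ x) = f (reC x) := by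
  induction x with
  | zero => simp
  | tmul c m => simp [reC_tmul]
  | add x y hx hy => simp [hx, hy]

lemma imC_baseChange (f : V →ₗ[ℝ] V) (x : ℂ ⊗[ℝ] V) : imC (f.baseChange ℂ x) = f (imC x) := by
  induction x with
  | zero => simp
  | tmul c m => simp [imC_tmul]
  | add x y hx hy => simp [hx, hy]

lemma reC_mem_of_mem_baseChange {p : Submodule ℝ V} {x : ℂ ⊗[ℝ] V} (hx : x ∈ p.baseChange ℂ) :
    reC x ∈ p := by
  obtain ⟨x, rfl⟩ := hx
  induction x with
  | zero => simp
  | tmul c m =>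
    rw [LinearMap.baseChange_tmul, reC_tmul]
    exact p.smul_mem _ m.2
  | add x y hx hy =>
    rw [map_add, map_add]
    exact p.add_mem hx hy

lemma imC_mem_of_mem_baseChange {p : Submodule ℝ V} {x : ℂ ⊗[ℝ] V} (hx : x ∈ p.baseChange ℂ) :
    imC x ∈ p := by
  obtain ⟨x, rfl⟩ := hx
  induction x with
  | zero => simp
  | tmul c m =>
    rw [LinearMap.baseChange_tmul, imC_tmul]
    exact p.smul_mem _ m.2
  | add x y hx hy =>
    rw [map_add, map_add]
    exact p.add_mem hx hy

end Complexification

namespace BanachLieSuperalgebra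
variable {𝔤 : Type*} [NormedAddCommGroup 𝔤] [NormedSpace ℝ 𝔤] [CompleteSpace 𝔤]
  (A : BanachLieSuperalgebra 𝔤)

lemma evenComponent_of_mem_odd {x : 𝔤} (hx : x ∈ A.part 1) : A.evenComponent x = 0 :=
  Submodule.projection_apply_of_mem_right _ hx

lemma oddComponent_of_mem_odd {x : 𝔤} (hx : x ∈ A.part 1) : A.oddComponent x = x :=
  Submodule.projection_apply_of_mem_left _ hx

end BanachLieSuperalgebra

namespace PreRepresentation
variable {E G 𝔤 : Type*}
  [NormedAddCommGroup E] [NormedSpace ℝ E] [CompleteSpace E]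
  [TopologicalSpace G] [T2Space G] [ChartedSpace E G] [Group G] [LieGroup 𝓘(ℝ, E) ω G]
  [NormedAddCommGroup 𝔤] [NormedSpace ℝ 𝔤] [CompleteSpace 𝔤]
  {S : BanachLieSupergroup E G 𝔤}
  {H : Type*} [NormedAddCommGroup H] [InnerProductSpace ℂ H] [CompleteSpace H]
  (P : PreRepresentation S H)

/-- For odd x the even summands of ρ̃(x) are closures of ρ(0), still with a domain to check; dπ(0)
supplies both the domain and the value on smooth vectors. -/
lemma mem_graph_closure_op_zero (v : P.π.smoothVectors E) :
    ((v : H), (0 : H)) ∈ (P.op 0).closure.graph := by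
  have h := P.generator_mem_closure_graph 0 ⟨v, P.π.mem_generator_domain v.2 _⟩
  rwa [P.π.generator_apply v.2, map_zero, Submodule.coe_zero,
    show P.π.orbitDeriv E (v : H) (0 : GroupLieAlgebra 𝓘(ℝ, E) G) = 0 from map_zero _] at h

/-- On smooth vectors, `ρ̃(a + i b)`, for `a` and `b` odd, is the complex-linear extension of the
odd action. -/
theorem exists_rhoTilde_apply {x : ℂ ⊗[ℝ] 𝔤} {a b : S.alg.part 1} (ha : reC x = a) (hb : imC x = b)
    (v : P.π.smoothVectors E) : ∃ h : (v : H) ∈ (P.rhoTilde x).domain,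
      P.rhoTilde x ⟨v, h⟩ = P.oddAction a v + Complex.I • P.oddAction b v := by
  have e : P.rhoTilde x = ((P.op 0).closure + Complex.I • (P.op 0).closure + (P.op (a : 𝔤)).closure
      + Complex.I • (P.op (b : 𝔤)).closure).domRestrict (P.π.smoothVectors E) := by
    rw [rhoTilde, ha, hb, S.alg.evenComponent_of_mem_odd a.2, S.alg.evenComponent_of_mem_odd b.2,
      S.alg.oddComponent_of_mem_odd a.2, S.alg.oddComponent_of_mem_odd b.2]
  obtain ⟨⟨u, hu⟩, rfl : u = v, h0⟩ := (LinearPMap.mem_graph_iff _).mp (P.mem_graph_closure_op_zero v)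
  rw [e]
  refine ⟨⟨v.2, ⟨⟨hu, hu⟩, P.mem_closure_odd_domain a v⟩, P.mem_closure_odd_domain b v⟩, ?_⟩
  change (P.op 0).closure ⟨_, hu⟩ + Complex.I • (P.op 0).closure ⟨_, hu⟩ + P.oddAction a v
    + Complex.I • P.oddAction b v = _
  rw [h0, smul_zero, add_zero, zero_add]

end PreRepresentation

end

theorem mainTheorem4 {E G 𝔤 H : Type*}
    [NormedAddCommGroup E] [NormedSpace ℝ E] [CompleteSpace E]
    [TopologicalSpace G] [T2Space G] [ChartedSpace E G] [Group G] [LieGroup 𝓘(ℝ, E) ω G]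
    [ConnectedSpace G]
    [NormedAddCommGroup 𝔤] [NormedSpace ℝ 𝔤] [CompleteSpace 𝔤]
    [TopologicalSpace.SeparableSpace 𝔤]
    [NormedAddCommGroup H] [InnerProductSpace ℂ H] [CompleteSpace H]
    [TopologicalSpace.SeparableSpace H]
    (S : BanachLieSupergroup E G 𝔤) (P : PreRepresentation S H)
    (g : G) (x : ℂ ⊗[ℝ] 𝔤) (hx : x ∈ S.alg.oddPartC)
    (v : H) (hv : v ∈ P.π.smoothVectors E) :
    ∃ (h₁ : (P.π.toHom g)⁻¹ v ∈ (P.rhoTilde x).domain)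
      (h₂ : v ∈ (P.rhoTilde (S.AdC g x)).domain),
      P.π.toHom g (P.rhoTilde x ⟨(P.π.toHom g)⁻¹ v, h₁⟩) = P.rhoTilde (S.AdC g x) ⟨v, h₂⟩ := by
  let a : S.alg.part 1 := ⟨reC x, reC_mem_of_mem_baseChange hx⟩
  let b : S.alg.part 1 := ⟨imC x, imC_mem_of_mem_baseChange hx⟩
  let v' : P.π.smoothVectors E := ⟨v, hv⟩
  -- Equivariance is used at the smooth vector π(g)⁻¹v, separately for the real and the imaginary
  -- part of `x`.
  obtain ⟨h₁, e₁⟩ := P.exists_rhoTilde_apply (x := x) (a := a) (b := b) rfl rfl (P.translate g⁻¹ v')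
  obtain ⟨h₂, e₂⟩ := P.exists_rhoTilde_apply (x := S.AdC g x) (a := PreRepresentation.adOdd S g a)
    (b := PreRepresentation.adOdd S g b) (reC_baseChange _ x) (imC_baseChange _ x) v'
  have hinv : (P.π.toHom g)⁻¹ v = (P.translate g⁻¹ v' : H) := P.π.toHom_inv_apply g v
  have hv' : P.translate g (P.translate g⁻¹ v') = v' := by
    rw [← P.translate_mul, mul_inv_cancel, P.translate_one]
  simp only [hinv]
  refine ⟨h₁, h₂, ?_⟩
  have ha := P.oddAction_equivariant g a (P.translate g⁻¹ v')
  have hb := P.oddAction_equivariant g b (P.translate g⁻¹ v')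
  rw [hv'] at ha hb
  rw [e₁, map_add, map_smul, ← ha, ← hb]
  exact e₂.symm
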